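/- Let $\Omega\subset\mathbb{R}^N$ be a non-empty open set and $1<p<\infty$. Let $W^{1,p}(\Omega)$ be the real first order Sobolev space with norm $\|u\|^p=\|u\|_{L^p(\Omega)}^p+\sum_{i=1}^N\|\partial_i u\|_{L^p(\Omega)}^p$, and let $\tilde W^{1,p}(\Omega)$ be the closure in $W^{1,p}(\Omega)$ of $\{f|_\Omega : f\in C_c(\overline\Omega),\ f|_\Omega\in W^{1,p}(\Omega)\}$. For $A\subset\overline\Omega$ the relative $p$-capacity is $$\mathrm{Cap}_{p,\Omega}(A)=\inf\{\|u\|^p : u\in\tilde W^{1,p}(\Omega),\ u\ge 1 \text{ a.e. on } O\cap\Omega \text{ for some } O\supset A \text{ open in } \overline\Omega\}\in[0,\infty].$$ A property holds q.e. on a set $S\subset\overline\Omega$ if the subset of $S$ where it fails has relative $p$-capacity zero. A function $u:\overline\Omega\to\mathbb{R}$ is quasi-continuous if for every $\varepsilon>0$ there is a set $V$, open in $\overline\Omega$, with $\mathrm{Cap}_{p,\Omega}(V)<\varepsilon$ such that $u|_{\overline\Omega\setminus V}$ is continuous. Let $\mathcal{W}^{1,p}(\Omega)$ be the set of all classes $[u]$,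 modulo equality q.e. on $\overline\Omega$, of quasi-continuous functions $u:\overline\Omega\to\mathbb{R}$ that agree a.e. on $\Omega$ with an element of $\tilde W^{1,p}(\Omega)$; the norm of $[u]$ is the $W^{1,p}(\Omega)$-norm of that element. Then for every $A\subset\overline\Omega$ with $\mathrm{Cap}_{p,\Omega}(A)<\infty$ there exists a unique $e_A\in\mathcal{W}^{1,p}(\Omega)$ such that $e_A\ge 1$ q.e. on $A$ and $\|e_A\|^p=\mathrm{Cap}_{p,\Omega}(A)$. Moreover, $0\le e_A\le 1$ q.e. on $\overline\Omega$ and $e_A=1$ q.e. on $A$. -/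

import Mathlib

open MeasureTheory Set
open scoped ENNReal

noncomputable section

namespace RelativeCapacity

/-- The Euclidean space `ℝ^N`. -/
abbrev Eucl (N : ℕ) : Type := EuclideanSpace ℝ (Fin N)

/-- The space `L^p(Ω)^{N+1}`. The coordinate `none` holds a function `u`, and the coordinate
`some i` a candidate for its partial derivative `∂_i u`. For `1 ≤ p < ∞` its norm is given by
`‖U‖ ^ p = ‖U none‖_{L^p(Ω)} ^ p + ∑ i, ‖U (some i)‖_{L^p(Ω)} ^ p`. -/
abbrev LpJet {N : ℕ} (p : ℝ≥0∞) (Ω : Set (Eucl N)) : Type :=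
  PiLp p (fun _ : Option (Fin N) => Lp ℝ p (volume.restrict Ω))

/-- `g` is the `i`-th partial derivative of `u` on `Ω` in the sense of distributions. -/
def IsWeakPartial {N : ℕ} (Ω : Set (Eucl N)) (i : Fin N) (u g : Eucl N → ℝ) : Prop :=
  ∀ φ : Eucl N → ℝ, ContDiff ℝ (⊤ : ℕ∞) φ → HasCompactSupport φ → tsupport φ ⊆ Ω →
    ∫ x in Ω, u x * fderiv ℝ φ x (EuclideanSpace.single i 1) = - ∫ x in Ω, g x * φ x

variable {N : ℕ} (p : ℝ≥0∞) (Ω : Set (Eucl N))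

/-- The Sobolev space `W^{1,p}(Ω)`. An element `u` is recorded together with its weak partial
derivatives, which are determined by `u`; the norm inherited from `LpJet p Ω` is the Sobolev norm
`‖u‖ ^ p = ∑_{|α| ≤ 1} ‖D^α u‖_{L^p(Ω)} ^ p`. -/
def sobolev : Set (LpJet p Ω) :=
  {U | ∀ i : Fin N, IsWeakPartial Ω i (U none) (U (some i))}

/-- `f` restricts to an element of `C_c(closure Ω)`; the values of `f` off `closure Ω` play no
role. -/
def IsCcClosure (f : Eucl N → ℝ) : Prop :=
  ContinuousOn f (closure Ω) ∧ ∃ K, IsCompact K ∧ ∀ x ∈ closure Ω \ K, f x = 0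

/-- `W^{1,p}(Ω) ∩ C_c(closure Ω)`. -/
def sobolevCc : Set (LpJet p Ω) :=
  {U | U ∈ sobolev p Ω ∧ ∃ f, IsCcClosure Ω f ∧ U none =ᵐ[volume.restrict Ω] f}

variable [Fact (1 ≤ p)]

/-- The closure of `W^{1,p}(Ω) ∩ C_c(closure Ω)` in `W^{1,p}(Ω)`. -/
def sobolevTilde : Set (LpJet p Ω) :=
  closure (sobolevCc p Ω) ∩ sobolev p Ω

/-- The admissible functions for `A ⊆ closure Ω`: those that are `≥ 1` a.e. on `O ∩ Ω` for some
`O ⊇ A` open in `closure Ω`. Here `O = V ∩ closure Ω` with `V` open in `ℝ^N`, so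
`O ∩ Ω = V ∩ Ω`. -/
def admissible (A : Set (Eucl N)) : Set (LpJet p Ω) :=
  {U | U ∈ sobolevTilde p Ω ∧ ∃ V, IsOpen V ∧ A ⊆ V ∧
    ∀ᵐ x ∂(volume.restrict (V ∩ Ω)), 1 ≤ U none x}

/-- The relative `p`-capacity of `A ⊆ closure Ω`, with value `∞` if no function is admissible. -/
def relCap (A : Set (Eucl N)) : ℝ≥0∞ :=
  ⨅ U ∈ admissible p Ω A, ‖U‖ₑ ^ p.toReal

/-- The property `P` holds quasi everywhere on `S ⊆ closure Ω`: its exceptional set in `S` has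
relative capacity zero. -/
def QEOn (S : Set (Eucl N)) (P : Eucl N → Prop) : Prop :=
  relCap p Ω {x ∈ S | ¬ P x} = 0

/-- `u` is quasi continuous on `closure Ω`: off sets `V ∩ closure Ω`, open in `closure Ω`, of
arbitrarily small relative capacity its restriction is continuous. Only the values of `u` on
`closure Ω` matter. -/
def IsQuasiCont (u : Eucl N → ℝ) : Prop :=
  ∀ ε : ℝ≥0∞, 0 < ε → ∃ V, IsOpen V ∧ relCap p Ω (V ∩ closure Ω) < ε ∧
    ContinuousOn u (closure Ω \ V)

/-- The equivalence class `[u]` of `u`: all quasi continuous functions that agree with `u` quasi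
everywhere on `closure Ω`. -/
def qeClass (u : Eucl N → ℝ) : Set (Eucl N → ℝ) :=
  {v | IsQuasiCont p Ω v ∧ QEOn p Ω (closure Ω) (fun x => v x = u x)}

/-- `c` is the class of a quasi continuous version of the Sobolev function `U`. -/
def IsRefinement (U : LpJet p Ω) (c : Set (Eucl N → ℝ)) : Prop :=
  ∃ u, IsQuasiCont p Ω u ∧ U none =ᵐ[volume.restrict Ω] u ∧ c = qeClass p Ω u

/-- The class `c` is a capacitary extremal for `A`: it belongs to the refined Sobolev space, that
is, it is the refinement of some `U` in `sobolevTilde p Ω` (whose norm is the norm of `c`), it is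
`≥ 1` quasi everywhere on `A`, and its norm to the power `p` is the relative capacity of `A`. -/
def IsExtremal (A : Set (Eucl N)) (c : Set (Eucl N → ℝ)) : Prop :=
  ∃ U ∈ sobolevTilde p Ω, IsRefinement p Ω U c ∧
    (∀ u ∈ c, QEOn p Ω A (fun x => 1 ≤ u x)) ∧ ‖U‖ₑ ^ p.toReal = relCap p Ω A

end RelativeCapacity

end

/-!
Minimizing the norm over the functions admissible for `A` does not suffice, as they need not form a
closed set. Enlarging this set to the functions in `W̃^{1,p}(Ω)` whose quasi continuous version is
`≥ 1` q.e. on `A` makes it closed and convex without lowering the infimum, which is still the `p`-th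
root of the capacity. Since `L^p(Ω)^{N+1}` is uniformly convex (Clarkson), the infimum is attained
at exactly one function `e`.

The quasi continuous version of a function in `W̃^{1,p}(Ω)` is the pointwise limit of a rapidly
converging sequence in `W^{1,p}(Ω) ∩ C_c(closure Ω)`. The convergence is uniform off sets of small
capacity by the Chebyshev inequality `Cap {u ≥ c} ≤ ‖u‖ ^ p / c ^ p` and the countable subadditivity
of `Cap ^ (1 / p)`, and the version is unique up to sets of capacity zero.

Truncations are replaced throughout by compositions with `C¹` functions `T` with `T 0 = 0` and
`0 ≤ T' ≤ 1`, for which the weak chain rule follows by mollification; these do not increase the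
Sobolev norm. If moreover `T 1 = 1`, then `T ∘ e` competes with `e`, so `T ∘ e = e` by uniqueness.
For a `T` whose fixed points are exactly those of `[0, 1]` this gives `0 ≤ e ≤ 1`.
-/

noncomputable section

namespace RelativeCapacity

open Filter Topology
open scoped Convolution

section Convergence

variable {α : Type*} [MeasurableSpace α] {μ : Measure α}

theorem tendsto_integral_norm_sub_of_integral_norm_le {E : Type*} [NormedAddCommGroup E]
    {F : ℕ → α → E} {f : α → E} (hF : ∀ n, Integrable (F n) μ) (hf : Integrable f μ)
    (hle : ∀ n, ∫ x, ‖F n x‖ ∂μ ≤ ∫ x, ‖f x‖ ∂μ)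
    (hlim : ∀ᵐ x ∂μ, Tendsto (fun n => F n x) atTop (𝓝 (f x))) :
    Tendsto (fun n => ∫ x, ‖F n x - f x‖ ∂μ) atTop (𝓝 0) := by
  set G : ℕ → α → ℝ := fun n x => ‖f x‖ + ‖F n x‖ - ‖F n x - f x‖ with hG
  have hGint : ∀ n, Integrable (G n) μ := fun n =>
    (hf.norm.add (hF n).norm).sub ((hF n).sub hf).norm
  have hGle : ∀ n x, ‖G n x‖ ≤ 2 * ‖f x‖ := fun n x => by
    have h₁ := norm_sub_le (F n x) (f x)
    have h₂ := norm_sub_norm_le (F n x) (f x)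
    rw [Real.norm_of_nonneg (by simp only [hG]; linarith)]
    simp only [hG]
    linarith
  have hGlim : Tendsto (fun n => ∫ x, G n x ∂μ) atTop (𝓝 (∫ x, 2 * ‖f x‖ ∂μ)) := by
    refine tendsto_integral_of_dominated_convergence (fun x => 2 * ‖f x‖)
      (fun n => (hGint n).aestronglyMeasurable) (hf.norm.const_mul 2)
      (fun n => Eventually.of_forall (hGle n)) ?_
    filter_upwards [hlim] with x hx
    simpa [two_mul] using (hx.norm.const_add ‖f x‖).sub (hx.sub_const (f x)).norm
  have hbound : ∀ n, ∫ x, ‖F n x - f x‖ ∂μ ≤ (∫ x, 2 * ‖f x‖ ∂μ) - ∫ x, G n x ∂μ := fun n => by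
    have hsum : ∫ x, G n x ∂μ =
        ∫ x, ‖f x‖ ∂μ + ∫ x, ‖F n x‖ ∂μ - ∫ x, ‖F n x - f x‖ ∂μ := by
      rw [← integral_add hf.norm (hF n).norm]
      exact integral_sub (hf.norm.add (hF n).norm) ((hF n).sub hf).norm
    rw [hsum, integral_const_mul]
    linarith [hle n]
  exact squeeze_zero (fun n => integral_nonneg fun x => norm_nonneg _) hbound
    (by simpa using hGlim.const_sub (∫ x, 2 * ‖f x‖ ∂μ))

theorem tendsto_integral_mul_of_tendsto_integral_abs_sub {F a : ℕ → α → ℝ} {f b : α → ℝ} {C : ℝ}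
    (hF : ∀ n, Integrable (F n) μ) (hf : Integrable f μ)
    (ha : ∀ n, AEStronglyMeasurable (a n) μ) (haC : ∀ n x, |a n x| ≤ C)
    (hFf : Tendsto (fun n => ∫ x, |F n x - f x| ∂μ) atTop (𝓝 0))
    (hab : ∀ᵐ x ∂μ, Tendsto (fun n => a n x) atTop (𝓝 (b x))) :
    Tendsto (fun n => ∫ x, F n x * a n x ∂μ) atTop (𝓝 (∫ x, f x * b x ∂μ)) := by
  have hmul : ∀ {w : α → ℝ} (n : ℕ), Integrable w μ → Integrable (fun x => w x * a n x) μ :=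
    fun n hw => hw.mul_bdd (ha n) (Eventually.of_forall (haC n))
  have hfixed : Tendsto (fun n => ∫ x, f x * a n x ∂μ) atTop (𝓝 (∫ x, f x * b x ∂μ)) := by
    refine tendsto_integral_of_dominated_convergence (fun x => |f x| * C)
      (fun n => (hmul n hf).aestronglyMeasurable) (hf.abs.mul_const C)
      (fun n => Eventually.of_forall fun x => ?_) ?_
    · rw [Real.norm_eq_abs, abs_mul]
      exact mul_le_mul_of_nonneg_left (haC n x) (abs_nonneg _)
    · filter_upwards [hab] with x hx using hx.const_mul (f x)
  have herror : Tendsto (fun n => ∫ x, (F n x - f x) * a n x ∂μ) atTop (𝓝 0) := by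
    refine squeeze_zero_norm (fun n => ?_) (by simpa using hFf.mul_const C)
    rw [← integral_mul_const]
    refine norm_integral_le_of_norm_le (((hF n).sub hf).abs.mul_const C)
      (Eventually.of_forall fun x => ?_)
    rw [Real.norm_eq_abs, abs_mul]
    exact mul_le_mul_of_nonneg_left (haC n x) (abs_nonneg _)
  have hsplit : ∀ n, ∫ x, F n x * a n x ∂μ =
      ∫ x, f x * a n x ∂μ + ∫ x, (F n x - f x) * a n x ∂μ := fun n => by
    have herr : Integrable (fun x => (F n x - f x) * a n x) μ := hmul n ((hF n).sub hf)
    rw [← integral_add (hmul n hf) herr]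
    exact integral_congr_ae (Eventually.of_forall fun x => by ring)
  simpa only [hsplit, add_zero] using hfixed.add herror

theorem tendsto_eLpNorm_mul_zero {p : ℝ≥0∞} (hp0 : p ≠ 0) (hp : p ≠ ∞) {f : α → ℝ}
    (hf : MemLp f p μ) {a : ℕ → α → ℝ} {C : ℝ} (ha : ∀ n, AEStronglyMeasurable (a n) μ)
    (haC : ∀ n, ∀ᵐ x ∂μ, |a n x| ≤ C)
    (ha0 : ∀ᵐ x ∂μ, Tendsto (fun n => a n x) atTop (𝓝 0)) :
    Tendsto (fun n => eLpNorm (fun x => a n x * f x) p μ) atTop (𝓝 0) := by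
  have hpr : 0 < p.toReal := ENNReal.toReal_pos hp0 hp
  have hbound : ∀ n, ∀ᵐ x ∂μ, ‖a n x * f x‖ₑ ≤ ‖C * f x‖ₑ := fun n => by
    filter_upwards [haC n] with x hx
    rw [enorm_le_iff_norm_le, norm_mul, norm_mul]
    exact mul_le_mul_of_nonneg_right (hx.trans (le_abs_self C)) (norm_nonneg _)
  have hpow : Tendsto (fun n => ∫⁻ x, ‖a n x * f x‖ₑ ^ p.toReal ∂μ) atTop (𝓝 (∫⁻ _, 0 ∂μ)) := by
    refine tendsto_lintegral_of_dominated_convergence' (fun x => ‖C * f x‖ₑ ^ p.toReal)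
      (fun n => ((ha n).mul hf.aestronglyMeasurable).enorm.pow_const _)
      (fun n => (hbound n).mono fun x hx => ENNReal.rpow_le_rpow hx hpr.le)
      (lintegral_rpow_enorm_lt_top_of_eLpNorm_lt_top hp0 hp (hf.const_mul C).2).ne ?_
    filter_upwards [ha0] with x hx
    have hx0 := (hx.mul_const (f x)).enorm
    rw [zero_mul, enorm_zero] at hx0
    simpa only [ENNReal.zero_rpow_of_pos hpr] using hx0.ennrpow_const p.toReal
  simpa only [eLpNorm_eq_lintegral_rpow_enorm_toReal hp0 hp, lintegral_zero,
    ENNReal.zero_rpow_of_pos (one_div_pos.2 hpr)] using hpow.ennrpow_const (1 / p.toReal)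

theorem tendsto_Lp_of_ae_eq_mul {p : ℝ≥0∞} [Fact (1 ≤ p)] (hp : p ≠ ∞) {F G : ℕ → Lp ℝ p μ}
    {f g : Lp ℝ p μ} {a : ℕ → α → ℝ} {b : α → ℝ} {C : ℝ}
    (hG : ∀ n, G n =ᵐ[μ] fun x => a n x * F n x) (hg : g =ᵐ[μ] fun x => b x * f x)
    (ha : ∀ n, AEStronglyMeasurable (a n) μ) (haC : ∀ n x, |a n x| ≤ C)
    (hF : Tendsto F atTop (𝓝 f)) (hab : ∀ᵐ x ∂μ, Tendsto (fun n => a n x) atTop (𝓝 (b x))) :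
    Tendsto G atTop (𝓝 g) := by
  have hp1 : 1 ≤ p := Fact.out
  have hb : AEStronglyMeasurable b μ := aestronglyMeasurable_of_tendsto_ae atTop ha hab
  have hbC : ∀ᵐ x ∂μ, |b x| ≤ C := by
    filter_upwards [hab] with x hx using le_of_tendsto' hx.abs fun n => haC n x
  have hcoeff : Tendsto (fun n => eLpNorm (fun x => (a n x - b x) * f x) p μ) atTop (𝓝 0) := by
    refine tendsto_eLpNorm_mul_zero (C := C + C) (zero_lt_one.trans_le hp1).ne' hp (Lp.memLp f)
      (fun n => (ha n).sub hb) (fun n => ?_) ?_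
    · filter_upwards [hbC] with x hx using (abs_sub _ _).trans (add_le_add (haC n x) hx)
    · filter_upwards [hab] with x hx using by simpa using hx.sub_const (b x)
  have hfun : Tendsto (fun n => ENNReal.ofReal C * eLpNorm (⇑(F n) - ⇑f) p μ) atTop (𝓝 0) := by
    simpa using ENNReal.Tendsto.const_mul (a := ENNReal.ofReal C)
      ((Lp.tendsto_Lp_iff_tendsto_eLpNorm' F f).1 hF)
      (Or.inr ENNReal.ofReal_ne_top)
  refine (Lp.tendsto_Lp_iff_tendsto_eLpNorm' G g).2 (tendsto_of_tendsto_of_tendsto_of_le_of_le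
    tendsto_const_nhds (by simpa using hfun.add hcoeff) (fun _ => zero_le) fun n => ?_)
  calc eLpNorm (⇑(G n) - ⇑g) p μ
      = eLpNorm ((fun x => a n x * (F n x - f x)) + fun x => (a n x - b x) * f x) p μ := by
        refine eLpNorm_congr_ae ?_
        filter_upwards [hG n, hg] with x hx hx'
        simp only [Pi.sub_apply, Pi.add_apply, hx, hx']
        ring
    _ ≤ eLpNorm (fun x => a n x * (F n x - f x)) p μ
        + eLpNorm (fun x => (a n x - b x) * f x) p μ :=
        eLpNorm_add_le ((ha n).mul ((Lp.aestronglyMeasurable _).sub (Lp.aestronglyMeasurable _)))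
          (((ha n).sub hb).mul (Lp.aestronglyMeasurable _)) hp1
    _ ≤ ENNReal.ofReal C * eLpNorm (⇑(F n) - ⇑f) p μ
        + eLpNorm (fun x => (a n x - b x) * f x) p μ := by
        gcongr
        refine eLpNorm_le_mul_eLpNorm_of_ae_le_mul (Eventually.of_forall fun x => ?_) p
        rw [norm_mul]
        exact mul_le_mul_of_nonneg_right (haC n x) (norm_nonneg _)

end Convergence

section Mollify

variable {E F : Type*} [NormedAddCommGroup E] [NormedSpace ℝ E] [FiniteDimensional ℝ E]
  [MeasurableSpace E] [BorelSpace E] [NormedAddCommGroup F] [NormedSpace ℝ F]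

/-- The mollification of `f` by the bump function `φ`, normalized to have integral `1`. -/
def mollify (φ : ContDiffBump (0 : E)) (μ : Measure E) (f : E → F) : E → F :=
  φ.normed μ ⋆[ContinuousLinearMap.lsmul ℝ ℝ, μ] f

variable {φ : ContDiffBump (0 : E)} {μ : Measure E} [μ.IsAddHaarMeasure] {f : E → F}

theorem mollify_apply (φ : ContDiffBump (0 : E)) (f : E → F) (x : E) :
    mollify φ μ f x = ∫ y, φ.normed μ (x - y) • f y ∂μ := by
  rw [mollify, convolution_eq_swap]
  rfl

theorem contDiff_mollify (φ : ContDiffBump (0 : E)) (hf : LocallyIntegrable f μ) :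
    ContDiff ℝ 1 (mollify φ μ f) :=
  φ.hasCompactSupport_normed.contDiff_convolution_left _ φ.contDiff_normed hf

theorem fderiv_mollify (φ : ContDiffBump (0 : E)) (hf : LocallyIntegrable f μ) (x v : E) :
    fderiv ℝ (mollify φ μ f) x v = ∫ y, fderiv ℝ (φ.normed μ) (x - y) v • f y ∂μ := by
  have hcompact := φ.hasCompactSupport_normed (μ := μ)
  have hderiv := hcompact.hasFDerivAt_convolution_left (ContinuousLinearMap.lsmul ℝ ℝ)
    (φ.contDiff_normed (n := 1)) hf x
  rw [mollify, hderiv.fderiv, convolution_eq_swap, ContinuousLinearMap.integral_apply]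
  · rfl
  · have hexists := (hcompact.fderiv ℝ).convolutionExists_left
      ((ContinuousLinearMap.lsmul ℝ ℝ : ℝ →L[ℝ] F →L[ℝ] F).precompL E)
      ((φ.contDiff_normed (n := 1) (μ := μ)).continuous_fderiv one_ne_zero) hf x
    exact hexists.integrable_swap

theorem integrable_mollify (φ : ContDiffBump (0 : E)) (hf : Integrable f μ) :
    Integrable (mollify φ μ f) μ :=
  φ.integrable_normed.integrable_convolution _ hf

theorem integral_norm_mollify_le (φ : ContDiffBump (0 : E)) (hf : Integrable f μ) :
    ∫ x, ‖mollify φ μ f x‖ ∂μ ≤ ∫ x, ‖f x‖ ∂μ := by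
  have hle : ∀ x, ‖mollify φ μ f x‖ ≤ mollify φ μ (fun y => ‖f y‖) x := fun x => by
    rw [mollify_apply, mollify_apply]
    refine (norm_integral_le_integral_norm _).trans_eq (integral_congr_ae ?_)
    exact Eventually.of_forall fun y => by
      simp only [norm_smul, Real.norm_of_nonneg (φ.nonneg_normed _), smul_eq_mul]
  calc ∫ x, ‖mollify φ μ f x‖ ∂μ
      ≤ ∫ x, mollify φ μ (fun y => ‖f y‖) x ∂μ :=
        integral_mono (integrable_mollify φ hf).norm (integrable_mollify φ hf.norm) hle
    _ = ∫ x, ‖f x‖ ∂μ := by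
        rw [mollify, integral_convolution _ φ.integrable_normed hf.norm, φ.integral_normed]
        simp

variable {ι : Type*} {l : Filter ι}

theorem ae_tendsto_mollify [CompleteSpace F] {φ : ι → ContDiffBump (0 : E)} {K : ℝ}
    (hφ : Tendsto (fun n => (φ n).rOut) l (𝓝 0))
    (hK : ∀ᶠ n in l, (φ n).rOut ≤ K * (φ n).rIn) (hf : LocallyIntegrable f μ) :
    ∀ᵐ x ∂μ, Tendsto (fun n => mollify (φ n) μ f x) l (𝓝 (f x)) :=
  ContDiffBump.ae_convolution_tendsto_right_of_locallyIntegrable hφ hK hf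

theorem tendsto_integral_norm_mollify_sub [CompleteSpace F] {φ : ℕ → ContDiffBump (0 : E)} {K : ℝ}
    (hφ : Tendsto (fun n => (φ n).rOut) atTop (𝓝 0))
    (hK : ∀ᶠ n in atTop, (φ n).rOut ≤ K * (φ n).rIn) (hf : Integrable f μ) :
    Tendsto (fun n => ∫ x, ‖mollify (φ n) μ f x - f x‖ ∂μ) atTop (𝓝 0) :=
  tendsto_integral_norm_sub_of_integral_norm_le (fun n => integrable_mollify (φ n) hf) hf
    (fun n => integral_norm_mollify_le (φ n) hf) (ae_tendsto_mollify hφ hK hf.locallyIntegrable)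

end Mollify

section SmoothContraction

/-- A continuously differentiable function `T` with `T 0 = 0` and `0 ≤ T' ≤ 1`. Composition with
such functions preserves Sobolev functions and does not increase their norm. -/
structure SmoothContraction (T : ℝ → ℝ) : Prop where
  contDiff : ContDiff ℝ 1 T
  deriv_mem_Icc : ∀ t, deriv T t ∈ Icc 0 1
  map_zero : T 0 = 0

namespace SmoothContraction

variable {T : ℝ → ℝ}

theorem continuous_deriv (hT : SmoothContraction T) : Continuous (deriv T) :=
  hT.contDiff.continuous_deriv le_rfl

theorem abs_deriv_le (hT : SmoothContraction T) (t : ℝ) : |deriv T t| ≤ 1 := by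
  rw [abs_of_nonneg (hT.deriv_mem_Icc t).1]
  exact (hT.deriv_mem_Icc t).2

theorem monotone (hT : SmoothContraction T) : Monotone T :=
  monotone_of_deriv_nonneg (hT.contDiff.differentiable one_ne_zero)
    fun t => (hT.deriv_mem_Icc t).1

theorem lipschitzWith (hT : SmoothContraction T) : LipschitzWith 1 T :=
  lipschitzWith_of_nnnorm_deriv_le (hT.contDiff.differentiable one_ne_zero) hT.abs_deriv_le

theorem abs_sub_le (hT : SmoothContraction T) (s t : ℝ) : |T s - T t| ≤ |s - t| := by
  simpa [Real.dist_eq] using hT.lipschitzWith.dist_le_mul s t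

theorem abs_le (hT : SmoothContraction T) (t : ℝ) : |T t| ≤ |t| := by
  simpa [hT.map_zero] using hT.abs_sub_le t 0

variable {α : Type*} [MeasurableSpace α] {μ : Measure α} {u : α → ℝ}

theorem integrable_comp (hT : SmoothContraction T) (hu : Integrable u μ) :
    Integrable (fun x => T (u x)) μ :=
  hu.mono (hT.contDiff.continuous.comp_aestronglyMeasurable hu.aestronglyMeasurable)
    (Eventually.of_forall fun x => hT.abs_le (u x))

theorem tendsto_integral_abs_comp_sub (hT : SmoothContraction T) {V : ℕ → α → ℝ}
    (hV : ∀ n, Integrable (V n) μ) (hu : Integrable u μ)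
    (hVu : Tendsto (fun n => ∫ x, |V n x - u x| ∂μ) atTop (𝓝 0)) :
    Tendsto (fun n => ∫ x, |T (V n x) - T (u x)| ∂μ) atTop (𝓝 0) :=
  squeeze_zero (fun _ => integral_nonneg fun _ => abs_nonneg _)
    (fun n => integral_mono ((hT.integrable_comp (hV n)).sub (hT.integrable_comp hu)).abs
      ((hV n).sub hu).abs fun _ => hT.abs_sub_le _ _) hVu

theorem integral_comp_mul_eq_neg_of_tendsto (hT : SmoothContraction T) {V W : ℕ → α → ℝ}
    {g φ ψ : α → ℝ} {C D : ℝ} (hV : ∀ n, Integrable (V n) μ) (hW : ∀ n, Integrable (W n) μ)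
    (hu : Integrable u μ) (hg : Integrable g μ) (hφ : AEStronglyMeasurable φ μ)
    (hψ : AEStronglyMeasurable ψ μ) (hC : ∀ x, |φ x| ≤ C) (hD : ∀ x, |ψ x| ≤ D)
    (hVu : ∀ᵐ x ∂μ, Tendsto (fun n => V n x) atTop (𝓝 (u x)))
    (hVu1 : Tendsto (fun n => ∫ x, |V n x - u x| ∂μ) atTop (𝓝 0))
    (hWg1 : Tendsto (fun n => ∫ x, |W n x - g x| ∂μ) atTop (𝓝 0))
    (hparts : ∀ n, ∫ x, T (V n x) * ψ x ∂μ = -∫ x, W n x * (deriv T (V n x) * φ x) ∂μ) :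
    ∫ x, T (u x) * ψ x ∂μ = -∫ x, g x * (deriv T (u x) * φ x) ∂μ := by
  have hleft : Tendsto (fun n => ∫ x, T (V n x) * ψ x ∂μ) atTop (𝓝 (∫ x, T (u x) * ψ x ∂μ)) :=
    tendsto_integral_mul_of_tendsto_integral_abs_sub (fun n => hT.integrable_comp (hV n))
      (hT.integrable_comp hu) (fun _ => hψ) (fun _ => hD)
      (hT.tendsto_integral_abs_comp_sub hV hu hVu1)
      (Eventually.of_forall fun _ => tendsto_const_nhds)
  have hright : Tendsto (fun n => ∫ x, W n x * (deriv T (V n x) * φ x) ∂μ) atTop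
      (𝓝 (∫ x, g x * (deriv T (u x) * φ x) ∂μ)) := by
    refine tendsto_integral_mul_of_tendsto_integral_abs_sub (C := C) hW hg
      (fun n => (hT.continuous_deriv.comp_aestronglyMeasurable (hV n).1).mul hφ)
      (fun n x => ?_) hWg1 ?_
    · rw [abs_mul]
      exact (mul_le_of_le_one_left (abs_nonneg _) (hT.abs_deriv_le _)).trans (hC x)
    · filter_upwards [hVu] with x hx using
        ((hT.continuous_deriv.tendsto _).comp hx).mul_const _
  exact tendsto_nhds_unique (hleft.congr hparts) hright.neg

end SmoothContraction

end SmoothContraction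

section ChainRule

variable {N : ℕ} {Ω : Set (Eucl N)} {i : Fin N} {u g : Eucl N → ℝ}

theorem setIntegral_mul_eq_integral_indicator_mul {α : Type*} [MeasurableSpace α] {μ : Measure α}
    {s K : Set α} (hKs : K ⊆ s) {ψ : α → ℝ} (hψ : ∀ x ∉ K, ψ x = 0) (f : α → ℝ) :
    ∫ x in s, f x * ψ x ∂μ = ∫ x, K.indicator f x * ψ x ∂μ := by
  rw [setIntegral_eq_integral_of_forall_compl_eq_zero fun x hx => by
    rw [hψ x fun hK => hx (hKs hK), mul_zero]]
  congr 1 with x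
  by_cases hx : x ∈ K
  · rw [indicator_of_mem hx]
  · rw [hψ x hx, mul_zero, mul_zero]

theorem fderiv_eq_zero_of_notMem_tsupport {E : Type*} [NormedAddCommGroup E] [NormedSpace ℝ E]
    {ψ : E → ℝ} {x : E} (hx : x ∉ tsupport ψ) : fderiv ℝ ψ x = 0 :=
  Function.notMem_support.1 fun h => hx (support_fderiv_subset ℝ h)

theorem IsWeakPartial.fderiv_mollify_indicator (h : IsWeakPartial Ω i u g) {K : Set (Eucl N)}
    (hK : MeasurableSet K) (hKΩ : K ⊆ Ω) (hu : IntegrableOn u K) (φ : ContDiffBump (0 : Eucl N))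
    {x : Eucl N} (hx : Metric.closedBall x φ.rOut ⊆ K) :
    fderiv ℝ (mollify φ volume (K.indicator u)) x (EuclideanSpace.single i 1) =
      mollify φ volume (K.indicator g) x := by
  set ρ : Eucl N → ℝ := φ.normed volume with hρ
  set ψ : Eucl N → ℝ := ρ ∘ Homeomorph.subLeft x with hψ
  have hρs : ContDiff ℝ (⊤ : ℕ∞) ρ := φ.contDiff_normed
  have hψs : ContDiff ℝ (⊤ : ℕ∞) ψ := hρs.comp (contDiff_const.sub contDiff_id)
  have hψc : HasCompactSupport ψ := φ.hasCompactSupport_normed.comp_homeomorph _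
  have hψK : tsupport ψ ⊆ K := by
    refine subset_trans (fun y hy => ?_) hx
    rw [hψ, tsupport_comp_eq_preimage, hρ, φ.tsupport_normed_eq] at hy
    simpa [dist_comm, dist_eq_norm] using hy
  have hψ' : ∀ y v, fderiv ℝ ψ y v = -fderiv ℝ ρ (x - y) v := fun y v => by
    have hsub : HasFDerivAt (fun y : Eucl N => x - y) (-ContinuousLinearMap.id ℝ (Eucl N)) y :=
      (hasFDerivAt_id y).const_sub x
    have hcomp : HasFDerivAt ψ _ y :=
      (hρs.differentiable (by simp) (x - y)).hasFDerivAt.comp y hsub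
    rw [hcomp.fderiv]
    simp
  have hweak := h ψ hψs hψc (hψK.trans hKΩ)
  rw [setIntegral_mul_eq_integral_indicator_mul hKΩ fun y hy => by
      rw [fderiv_eq_zero_of_notMem_tsupport fun hy' => hy (hψK hy'), zero_apply],
    setIntegral_mul_eq_integral_indicator_mul hKΩ
      fun y hy => image_eq_zero_of_notMem_tsupport fun hy' => hy (hψK hy')] at hweak
  rw [fderiv_mollify φ ((integrable_indicator_iff hK).2 hu).locallyIntegrable, mollify_apply,
    ← neg_inj]
  simpa only [smul_eq_mul, mul_comm, hψ', mul_neg, integral_neg] using! hweak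

theorem exists_contDiffBump_tendsto_rOut {E : Type*} [NormedAddCommGroup E] {r : ℝ} (hr : 0 < r) :
    ∃ φ : ℕ → ContDiffBump (0 : E),
      (∀ n, (φ n).rOut ≤ r) ∧ (∀ n, (φ n).rOut ≤ 2 * (φ n).rIn) ∧
      Tendsto (fun n => (φ n).rOut) atTop (𝓝 0) := by
  have hpos : ∀ n : ℕ, 0 < r / (n + 1) := fun n => by positivity
  refine ⟨fun n => ⟨r / (n + 1) / 2, r / (n + 1), half_pos (hpos n), half_lt_self (hpos n)⟩,
    fun n => div_le_self hr.le (by simp), fun n => by simp [mul_div_cancel₀], ?_⟩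
  simpa [div_eq_mul_inv] using (tendsto_one_div_add_atTop_nhds_zero_nat (𝕜 := ℝ)).const_mul r

theorem IsWeakPartial.exists_contDiff_tendsto (hΩ : IsOpen Ω) (h : IsWeakPartial Ω i u g)
    (hu : LocallyIntegrableOn u Ω) (hg : LocallyIntegrableOn g Ω) {K : Set (Eucl N)}
    (hK : IsCompact K) (hKΩ : K ⊆ Ω) :
    ∃ V : ℕ → Eucl N → ℝ, (∀ n, ContDiff ℝ 1 (V n)) ∧
      (∀ᵐ x ∂volume.restrict K, Tendsto (fun n => V n x) atTop (𝓝 (u x))) ∧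
      Tendsto (fun n => ∫ x in K, |V n x - u x|) atTop (𝓝 0) ∧
      Tendsto (fun n => ∫ x in K, |fderiv ℝ (V n) x (EuclideanSpace.single i 1) - g x|)
        atTop (𝓝 0) := by
  obtain ⟨r, hr, hrΩ⟩ := hK.exists_cthickening_subset_open hΩ hKΩ
  obtain ⟨φ, hφr, hφK, hφ0⟩ := exists_contDiffBump_tendsto_rOut (E := Eucl N) hr
  set L := Metric.cthickening r K
  have hL : IsCompact L := hK.cthickening
  have hKL : K ⊆ L := Metric.self_subset_cthickening K
  have huL : IntegrableOn u L := hu.integrableOn_compact_subset hrΩ hL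
  have hint : ∀ {f : Eucl N → ℝ}, LocallyIntegrableOn f Ω → Integrable (L.indicator f) :=
    fun hf => (hf.integrableOn_compact_subset hrΩ hL).integrable_indicator hL.measurableSet
  have htend : ∀ {f : Eucl N → ℝ}, LocallyIntegrableOn f Ω → Tendsto
      (fun n => ∫ x in K, |mollify (φ n) volume (L.indicator f) x - f x|) atTop (𝓝 0) := by
    intro f hf
    refine squeeze_zero (fun n => integral_nonneg fun x => abs_nonneg _) (fun n => ?_)
      (tendsto_integral_norm_mollify_sub hφ0 (Eventually.of_forall hφK) (hint hf))
    calc ∫ x in K, |mollify (φ n) volume (L.indicator f) x - f x|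
        = ∫ x in K, ‖mollify (φ n) volume (L.indicator f) x - L.indicator f x‖ :=
          setIntegral_congr_fun hK.measurableSet fun x hx => by
            simp only [indicator_of_mem (hKL hx), Real.norm_eq_abs]
      _ ≤ ∫ x, ‖mollify (φ n) volume (L.indicator f) x - L.indicator f x‖ :=
          setIntegral_le_integral ((integrable_mollify _ (hint hf)).sub (hint hf)).norm
            (Eventually.of_forall fun x => norm_nonneg _)
  refine ⟨fun n => mollify (φ n) volume (L.indicator u),
    fun n => contDiff_mollify _ (hint hu).locallyIntegrable, ?_, htend hu,
    (htend hg).congr fun n => setIntegral_congr_fun hK.measurableSet fun x hx => ?_⟩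
  · filter_upwards [ae_restrict_of_ae (ae_tendsto_mollify hφ0 (Eventually.of_forall hφK)
      (hint hu).locallyIntegrable), ae_restrict_mem hK.measurableSet] with x hx hxK
    rwa [indicator_of_mem (hKL hxK)] at hx
  · simp only [h.fderiv_mollify_indicator hL.measurableSet hrΩ huL (φ n)
      ((Metric.closedBall_subset_closedBall (hφr n)).trans
        (Metric.closedBall_subset_cthickening hx r))]

theorem integral_comp_mul_fderiv_eq_neg {E : Type*} [NormedAddCommGroup E] [NormedSpace ℝ E]
    [FiniteDimensional ℝ E] [MeasurableSpace E] [BorelSpace E] {μ : Measure E}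
    [μ.IsAddHaarMeasure] {T : ℝ → ℝ} (hT : ContDiff ℝ 1 T) {V φ : E → ℝ} (hV : ContDiff ℝ 1 V)
    (hφ : ContDiff ℝ 1 φ) (hφc : HasCompactSupport φ) (v : E) :
    ∫ x, T (V x) * fderiv ℝ φ x v ∂μ = -∫ x, fderiv ℝ V x v * (deriv T (V x) * φ x) ∂μ := by
  have hTV : ContDiff ℝ 1 (fun x => T (V x)) := hT.comp hV
  have hφc' : HasCompactSupport fun x => fderiv ℝ φ x v := hφc.fderiv_apply ℝ v
  have hchain : ∀ x, fderiv ℝ (fun x => T (V x)) x v = deriv T (V x) * fderiv ℝ V x v := fun x => by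
    have hcomp := (hT.differentiable one_ne_zero (V x)).hasDerivAt.comp_hasFDerivAt x
      (hV.differentiable one_ne_zero x).hasFDerivAt
    rw [show fderiv ℝ (fun x => T (V x)) x = _ from hcomp.fderiv]
    simp
  have hderiv : ∀ {f : E → ℝ}, ContDiff ℝ 1 f → Continuous fun x => fderiv ℝ f x v :=
    fun hf => (hf.continuous_fderiv one_ne_zero).clm_apply continuous_const
  rw [integral_mul_fderiv_eq_neg_fderiv_mul_of_integrable
    (((hderiv hTV).mul hφ.continuous).integrable_of_hasCompactSupport hφc.mul_left)
    ((hTV.continuous.mul (hderiv hφ)).integrable_of_hasCompactSupport hφc'.mul_left)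
    ((hTV.continuous.mul hφ.continuous).integrable_of_hasCompactSupport hφc.mul_left)
    (fun x _ => hTV.differentiable one_ne_zero x) (fun x _ => hφ.differentiable one_ne_zero x)]
  simp only [hchain, mul_comm, mul_assoc]

theorem IsWeakPartial.comp (hΩ : IsOpen Ω) (h : IsWeakPartial Ω i u g)
    (hu : LocallyIntegrableOn u Ω) (hg : LocallyIntegrableOn g Ω) {T : ℝ → ℝ}
    (hT : SmoothContraction T) :
    IsWeakPartial Ω i (fun x => T (u x)) (fun x => deriv T (u x) * g x) := by
  intro φ hφ hφc hφΩ
  set K := tsupport φ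
  set e : Eucl N := EuclideanSpace.single i 1
  have hφ1 : ContDiff ℝ 1 φ := hφ.of_le (by simp)
  have hφ' : Continuous fun x => fderiv ℝ φ x e :=
    (hφ1.continuous_fderiv one_ne_zero).clm_apply continuous_const
  obtain ⟨C, hC⟩ := hφc.exists_bound_of_continuous hφ.continuous
  obtain ⟨D, hD⟩ := (hφc.fderiv_apply ℝ e).exists_bound_of_continuous hφ'
  have hcont : ∀ {f : Eucl N → ℝ}, Continuous f → IntegrableOn f K :=
    fun hf => hf.continuousOn.integrableOn_compact hφc
  have huK : IntegrableOn u K := hu.integrableOn_compact_subset hφΩ hφc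
  have hgK : IntegrableOn g K := hg.integrableOn_compact_subset hφΩ hφc
  obtain ⟨V, hV, hVu, hVu1, hVg1⟩ := h.exists_contDiff_tendsto hΩ hu hg hφc hφΩ
  have hφ0 : ∀ x ∉ K, φ x = 0 := fun x hx => image_eq_zero_of_notMem_tsupport hx
  have hφ0' : ∀ x ∉ K, fderiv ℝ φ x e = 0 := fun x hx => by
    rw [fderiv_eq_zero_of_notMem_tsupport hx, zero_apply]
  have hparts : ∀ n, ∫ x in K, T (V n x) * fderiv ℝ φ x e =
      -∫ x in K, fderiv ℝ (V n) x e * (deriv T (V n x) * φ x) := fun n => by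
    rw [setIntegral_eq_integral_of_forall_compl_eq_zero fun x hx => by simp [hφ0' x hx],
      setIntegral_eq_integral_of_forall_compl_eq_zero fun x hx => by simp [hφ0 x hx],
      integral_comp_mul_fderiv_eq_neg hT.contDiff (hV n) hφ1 hφc]
  rw [setIntegral_eq_of_subset_of_forall_sdiff_eq_zero hΩ.measurableSet hφΩ
      fun x hx => by simp [hφ0' x hx.2],
    setIntegral_eq_of_subset_of_forall_sdiff_eq_zero hΩ.measurableSet hφΩ
      fun x hx => by simp [hφ0 x hx.2]]
  simpa only [mul_comm, mul_left_comm] using hT.integral_comp_mul_eq_neg_of_tendsto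
    (fun n => hcont (hV n).continuous)
    (fun n => hcont (((hV n).continuous_fderiv one_ne_zero).clm_apply continuous_const)) huK hgK
    hφ.continuous.aestronglyMeasurable hφ'.aestronglyMeasurable hC hD hVu hVu1 hVg1 hparts

end ChainRule

section Jets

variable {N : ℕ} {p : ℝ≥0∞} {Ω : Set (Eucl N)}

theorem coeFn_add_none (U V : LpJet p Ω) :
    (U + V) none =ᵐ[volume.restrict Ω] fun x => U none x + V none x :=
  Lp.coeFn_add (U none) (V none)

theorem coeFn_sub_none (U V : LpJet p Ω) :
    (U - V) none =ᵐ[volume.restrict Ω] fun x => U none x - V none x :=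
  Lp.coeFn_sub (U none) (V none)

theorem coeFn_smul_none (c : ℝ) (U : LpJet p Ω) :
    (c • U) none =ᵐ[volume.restrict Ω] fun x => c * U none x :=
  Lp.coeFn_smul c (U none)

theorem IsCcClosure.add {f g : Eucl N → ℝ} (hf : IsCcClosure Ω f) (hg : IsCcClosure Ω g) :
    IsCcClosure Ω (fun x => f x + g x) := by
  obtain ⟨hfcont, K, hK, hfK⟩ := hf
  obtain ⟨hgcont, L, hL, hgL⟩ := hg
  refine ⟨hfcont.add hgcont, K ∪ L, hK.union hL, fun x hx => ?_⟩
  simp only [Set.mem_sdiff, mem_union, not_or] at hx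
  simp only [hfK x ⟨hx.1, hx.2.1⟩, hgL x ⟨hx.1, hx.2.2⟩, add_zero]

theorem IsCcClosure.comp {f : Eucl N → ℝ} (hf : IsCcClosure Ω f) {T : ℝ → ℝ}
    (hT : Continuous T) (hT0 : T 0 = 0) : IsCcClosure Ω (fun x => T (f x)) := by
  obtain ⟨hfcont, K, hK, hfK⟩ := hf
  exact ⟨hT.comp_continuousOn hfcont, K, hK, fun x hx => by simp only [hfK x hx, hT0]⟩

variable [Fact (1 ≤ p)]

theorem exists_clm_integral_mul {α : Type*} [MeasurableSpace α] {μ : Measure α} {q : ℝ≥0∞}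
    [ENNReal.HolderConjugate p q] {h : α → ℝ} (hh : MemLp h q μ) :
    ∃ ℓ : Lp ℝ p μ →L[ℝ] ℝ, ∀ f, ℓ f = ∫ x, f x * h x ∂μ := by
  have : Fact (1 ≤ q) := ⟨ENNReal.HolderTriple.le _ p 1⟩
  refine ⟨((ContinuousLinearMap.mul ℝ ℝ).lpPairing μ p q).flip (hh.toLp h), fun f => ?_⟩
  rw [ContinuousLinearMap.flip_apply, ContinuousLinearMap.lpPairing_eq_integral]
  refine integral_congr_ae ?_
  filter_upwards [hh.coeFn_toLp] with x hx
  simp [hx]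

theorem exists_clm_eq_zero_iff_integral_eq (i : Fin N) {φ : Eucl N → ℝ}
    (hφ : ContDiff ℝ (⊤ : ℕ∞) φ) (hφc : HasCompactSupport φ) :
    ∃ ℓ : LpJet p Ω →L[ℝ] ℝ, ∀ U : LpJet p Ω, ℓ U = 0 ↔
      ∫ x in Ω, U none x * fderiv ℝ φ x (EuclideanSpace.single i 1) =
        -∫ x in Ω, U (some i) x * φ x := by
  have : ENNReal.HolderConjugate p (ENNReal.conjExponent p) := .conjExponent Fact.out
  have hφ' : Continuous fun x => fderiv ℝ φ x (EuclideanSpace.single i 1) :=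
    (hφ.continuous_fderiv (by simp)).clm_apply continuous_const
  obtain ⟨ℓ₁, h₁⟩ := exists_clm_integral_mul (p := p) (q := ENNReal.conjExponent p)
    ((hφ'.memLp_of_hasCompactSupport (μ := volume) (hφc.fderiv_apply ℝ _)).restrict Ω)
  obtain ⟨ℓ₂, h₂⟩ := exists_clm_integral_mul (p := p) (q := ENNReal.conjExponent p)
    ((hφ.continuous.memLp_of_hasCompactSupport (μ := volume) hφc).restrict Ω)
  refine ⟨ℓ₁.comp (PiLp.proj p _ none) + ℓ₂.comp (PiLp.proj p _ (some i)), fun U => ?_⟩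
  rw [eq_neg_iff_add_eq_zero, ← h₁, ← h₂]
  rfl

variable (p Ω)

/-- The Sobolev space `W^{1,p}(Ω)` as a subspace of the space of jets. -/
def sobolevSubmodule : Submodule ℝ (LpJet p Ω) where
  carrier := sobolev p Ω
  zero_mem' i φ hφ hφc _ := by
    obtain ⟨ℓ, hℓ⟩ := exists_clm_eq_zero_iff_integral_eq (p := p) (Ω := Ω) i hφ hφc
    exact (hℓ 0).1 (map_zero ℓ)
  add_mem' {U V} hU hV i φ hφ hφc hφΩ := by
    obtain ⟨ℓ, hℓ⟩ := exists_clm_eq_zero_iff_integral_eq (p := p) (Ω := Ω) i hφ hφc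
    refine (hℓ (U + V)).1 ?_
    rw [map_add, (hℓ U).2 (hU i φ hφ hφc hφΩ), (hℓ V).2 (hV i φ hφ hφc hφΩ), add_zero]
  smul_mem' c U hU i φ hφ hφc hφΩ := by
    obtain ⟨ℓ, hℓ⟩ := exists_clm_eq_zero_iff_integral_eq (p := p) (Ω := Ω) i hφ hφc
    refine (hℓ (c • U)).1 ?_
    rw [map_smul, (hℓ U).2 (hU i φ hφ hφc hφΩ), smul_zero]

theorem isClosed_sobolev : IsClosed (sobolev p Ω) := by
  simp only [sobolev, IsWeakPartial, ofPred_forall]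
  refine isClosed_iInter fun i => isClosed_iInter fun φ => isClosed_iInter fun hφ =>
    isClosed_iInter fun hφc => isClosed_iInter fun _ => ?_
  obtain ⟨ℓ, hℓ⟩ := exists_clm_eq_zero_iff_integral_eq (p := p) (Ω := Ω) i hφ hφc
  simp only [← hℓ]
  exact isClosed_eq ℓ.continuous continuous_const

/-- `W^{1,p}(Ω) ∩ C_c(closure Ω)` as a subspace of the space of jets. -/
def sobolevCcSubmodule : Submodule ℝ (LpJet p Ω) where
  carrier := sobolevCc p Ω
  zero_mem' := ⟨(sobolevSubmodule p Ω).zero_mem, fun _ => 0,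
    ⟨continuousOn_const, ∅, isCompact_empty, fun _ _ => rfl⟩, Lp.coeFn_zero _ _ _⟩
  add_mem' := by
    rintro U V ⟨hU, f, hf, hUf⟩ ⟨hV, g, hg, hVg⟩
    refine ⟨(sobolevSubmodule p Ω).add_mem hU hV, _, hf.add hg, ?_⟩
    filter_upwards [coeFn_add_none U V, hUf, hVg] with x hx hxf hxg
    rw [hx, hxf, hxg]
  smul_mem' := by
    rintro c U ⟨hU, f, hf, hUf⟩
    refine ⟨(sobolevSubmodule p Ω).smul_mem c hU, _,
      hf.comp (continuous_const_mul c) (mul_zero c), ?_⟩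
    filter_upwards [coeFn_smul_none c U, hUf] with x hx hxf
    rw [hx, hxf]

theorem sobolevTilde_eq_closure : sobolevTilde p Ω = closure (sobolevCc p Ω) :=
  inter_eq_left.2 (closure_minimal (fun _ h => h.1) (isClosed_sobolev p Ω))

/-- The space `W̃^{1,p}(Ω)` as a subspace of the space of jets. -/
def sobolevTildeSubmodule : Submodule ℝ (LpJet p Ω) :=
  (sobolevCcSubmodule p Ω).topologicalClosure.copy (sobolevTilde p Ω)
    (sobolevTilde_eq_closure p Ω)

theorem isClosed_sobolevTilde : IsClosed (sobolevTilde p Ω) := by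
  rw [sobolevTilde_eq_closure]
  exact isClosed_closure

variable {p Ω}

theorem tendsto_coord {U : ℕ → LpJet p Ω} {V : LpJet p Ω} (h : Tendsto U atTop (𝓝 V))
    (j : Option (Fin N)) : Tendsto (fun n => U n j) atTop (𝓝 (V j)) :=
  ((PiLp.proj (𝕜 := ℝ) p (fun _ => Lp ℝ p (volume.restrict Ω)) j).continuous.tendsto V).comp h

theorem exists_subseq_ae_tendsto {U : ℕ → LpJet p Ω} {V : LpJet p Ω}
    (h : Tendsto U atTop (𝓝 V)) : ∃ ns : ℕ → ℕ, StrictMono ns ∧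
      ∀ᵐ x ∂volume.restrict Ω, Tendsto (fun k => U (ns k) none x) atTop (𝓝 (V none x)) :=
  (tendstoInMeasure_of_tendsto_Lp (tendsto_coord h none)).exists_seq_tendsto_ae

theorem exists_seq_sobolevCc_ae_tendsto {U : LpJet p Ω} (hU : U ∈ sobolevTilde p Ω)
    {δ : ℕ → ℝ} (hδ : ∀ k, 0 < δ k) :
    ∃ F : ℕ → LpJet p Ω, (∀ k, F k ∈ sobolevCc p Ω) ∧ (∀ k, dist (F k) U ≤ δ k) ∧
      ∀ᵐ x ∂volume.restrict Ω, Tendsto (fun k => F k none x) atTop (𝓝 (U none x)) := by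
  obtain ⟨F, hF, hFU⟩ := mem_closure_iff_seq_limit.1 hU.1
  obtain ⟨ns, hns, hae⟩ := exists_subseq_ae_tendsto hFU
  have hclose : ∀ k, ∃ m ≥ k, dist (F (ns m)) U ≤ δ k := fun k =>
    ((eventually_ge_atTop k).and ((hFU.comp hns.tendsto_atTop).eventually
      (Metric.closedBall_mem_nhds U (hδ k)))).exists
  choose m hm hmδ using hclose
  refine ⟨fun k => F (ns (m k)), fun k => hF _, hmδ, ?_⟩
  filter_upwards [hae] with x hx using hx.comp (tendsto_atTop_mono hm tendsto_id)

theorem norm_le_norm_of_forall_norm_le (hp : p ≠ ∞) {U V : LpJet p Ω} (h : ∀ j, ‖U j‖ ≤ ‖V j‖) :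
    ‖U‖ ≤ ‖V‖ := by
  have hp1 : 1 ≤ p := Fact.out
  have hpr : 0 < p.toReal := ENNReal.toReal_pos (zero_lt_one.trans_le hp1).ne' hp
  rw [PiLp.norm_eq_sum hpr, PiLp.norm_eq_sum hpr]
  gcongr with j
  exact h j

end Jets

section Composition

variable {N : ℕ} {p : ℝ≥0∞} {Ω : Set (Eucl N)} {T : ℝ → ℝ}

theorem SmoothContraction.memLp_deriv_mul {α : Type*} [MeasurableSpace α] {μ : Measure α}
    (hT : SmoothContraction T) (u g : Lp ℝ p μ) : MemLp (fun x => deriv T (u x) * g x) p μ :=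
  (Lp.memLp g).mono ((hT.continuous_deriv.comp_aestronglyMeasurable
    (Lp.aestronglyMeasurable u)).mul (Lp.aestronglyMeasurable g))
    (Eventually.of_forall fun _ => by
      rw [norm_mul]
      exact mul_le_of_le_one_left (norm_nonneg _) (hT.abs_deriv_le _))

/-- The composition `T ∘ U` of a Sobolev function with a smooth contraction, its partial
derivatives being given by the chain rule. -/
def compJet (hT : SmoothContraction T) (U : LpJet p Ω) : LpJet p Ω :=
  WithLp.toLp p fun
    | none => hT.lipschitzWith.compLp hT.map_zero (U none)
    | some i => (hT.memLp_deriv_mul (U none) (U (some i))).toLp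

theorem coeFn_compJet_none (hT : SmoothContraction T) (U : LpJet p Ω) :
    compJet hT U none =ᵐ[volume.restrict Ω] fun x => T (U none x) :=
  hT.lipschitzWith.coeFn_compLp hT.map_zero (U none)

theorem coeFn_compJet_some (hT : SmoothContraction T) (U : LpJet p Ω) (i : Fin N) :
    compJet hT U (some i) =ᵐ[volume.restrict Ω] fun x => deriv T (U none x) * U (some i) x :=
  (hT.memLp_deriv_mul (U none) (U (some i))).coeFn_toLp

variable [Fact (1 ≤ p)]

theorem norm_compJet_le (hp : p ≠ ∞) (hT : SmoothContraction T) (U : LpJet p Ω) :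
    ‖compJet hT U‖ ≤ ‖U‖ := by
  refine norm_le_norm_of_forall_norm_le hp fun j => Lp.norm_le_norm_of_ae_le ?_
  cases j with
  | none =>
    filter_upwards [coeFn_compJet_none hT U] with x hx
    rw [hx]
    exact hT.abs_le _
  | some i =>
    filter_upwards [coeFn_compJet_some hT U i] with x hx
    rw [hx, norm_mul]
    exact mul_le_of_le_one_left (norm_nonneg _) (hT.abs_deriv_le _)

theorem locallyIntegrableOn_coeFn (hΩ : IsOpen Ω) (u : Lp ℝ p (volume.restrict Ω)) :
    LocallyIntegrableOn u Ω := by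
  rw [locallyIntegrableOn_iff hΩ.isLocallyClosed]
  intro K hK hKc
  have : IsFiniteMeasure (volume.restrict K) := ⟨by simpa using hKc.measure_lt_top⟩
  exact ((Lp.memLp u).mono_measure (Measure.restrict_mono_set _ hK)).integrable Fact.out

theorem compJet_mem_sobolev (hΩ : IsOpen Ω) (hT : SmoothContraction T) {U : LpJet p Ω}
    (hU : U ∈ sobolev p Ω) : compJet hT U ∈ sobolev p Ω := by
  intro i φ hφ hφc hφΩ
  have hnone : ∫ x in Ω, compJet hT U none x * fderiv ℝ φ x (EuclideanSpace.single i 1) =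
      ∫ x in Ω, T (U none x) * fderiv ℝ φ x (EuclideanSpace.single i 1) :=
    integral_congr_ae (by filter_upwards [coeFn_compJet_none hT U] with x hx; rw [hx])
  have hsome : ∫ x in Ω, compJet hT U (some i) x * φ x =
      ∫ x in Ω, deriv T (U none x) * U (some i) x * φ x :=
    integral_congr_ae (by filter_upwards [coeFn_compJet_some hT U i] with x hx; rw [hx])
  rw [hnone, hsome]
  exact (hU i).comp hΩ (locallyIntegrableOn_coeFn hΩ _) (locallyIntegrableOn_coeFn hΩ _) hT
    φ hφ hφc hφΩ

theorem tendsto_compJet (hp : p ≠ ∞) (hT : SmoothContraction T) {U : ℕ → LpJet p Ω}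
    {V : LpJet p Ω} (h : Tendsto U atTop (𝓝 V))
    (hae : ∀ᵐ x ∂volume.restrict Ω, Tendsto (fun k => U k none x) atTop (𝓝 (V none x))) :
    Tendsto (fun n => compJet hT (U n)) atTop (𝓝 (compJet hT V)) := by
  have hcoord : ∀ j, Tendsto (fun n => compJet hT (U n) j) atTop (𝓝 (compJet hT V j)) := by
    rintro (_ | i)
    · exact ((hT.lipschitzWith.continuous_compLp hT.map_zero).tendsto _).comp (tendsto_coord h none)
    · refine tendsto_Lp_of_ae_eq_mul hp (fun n => coeFn_compJet_some hT (U n) i)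
        (coeFn_compJet_some hT V i) (fun n => hT.continuous_deriv.comp_aestronglyMeasurable
          (Lp.aestronglyMeasurable _)) (fun n x => hT.abs_deriv_le _) (tendsto_coord h (some i)) ?_
      filter_upwards [hae] with x hx using (hT.continuous_deriv.tendsto _).comp hx
  exact ((PiLp.continuous_toLp p (fun _ : Option (Fin N) => Lp ℝ p (volume.restrict Ω))).tendsto
    (WithLp.ofLp (compJet hT V))).comp (tendsto_pi_nhds.2 hcoord)

theorem compJet_mem_sobolevCc (hΩ : IsOpen Ω) (hT : SmoothContraction T) {U : LpJet p Ω}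
    (hU : U ∈ sobolevCc p Ω) : compJet hT U ∈ sobolevCc p Ω := by
  obtain ⟨hUs, f, hf, hUf⟩ := hU
  refine ⟨compJet_mem_sobolev hΩ hT hUs, _, hf.comp hT.contDiff.continuous hT.map_zero, ?_⟩
  filter_upwards [coeFn_compJet_none hT U, hUf] with x hx hxf
  rw [hx, hxf]

theorem compJet_mem_sobolevTilde (hΩ : IsOpen Ω) (hp : p ≠ ∞) (hT : SmoothContraction T)
    {U : LpJet p Ω} (hU : U ∈ sobolevTilde p Ω) : compJet hT U ∈ sobolevTilde p Ω := by
  obtain ⟨F, hF, hFU, hae⟩ := exists_seq_sobolevCc_ae_tendsto hU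
    (δ := fun n => 1 / ((n : ℝ) + 1)) fun n => Nat.one_div_pos_of_nat
  have hlim : Tendsto F atTop (𝓝 U) := tendsto_iff_dist_tendsto_zero.2
    (squeeze_zero (fun _ => dist_nonneg) hFU tendsto_one_div_add_atTop_nhds_zero_nat)
  rw [sobolevTilde_eq_closure]
  exact mem_closure_of_tendsto (tendsto_compJet hp hT hlim hae)
    (Eventually.of_forall fun n => compJet_mem_sobolevCc hΩ hT (hF n))

end Composition

section SoftTruncation

theorem smoothContraction_integral {w : ℝ → ℝ} (hw : Continuous w) (hw01 : ∀ t, w t ∈ Icc 0 1) :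
    SmoothContraction fun t => ∫ s in 0..t, w s where
  contDiff := contDiff_one_iff_deriv.2
    ⟨fun t => (hw.integral_hasStrictDerivAt 0 t).hasDerivAt.differentiableAt, by
      rwa [show deriv (fun t => ∫ s in 0..t, w s) = w from
        funext fun t => hw.deriv_integral w 0 t]⟩
  deriv_mem_Icc t := (hw.deriv_integral w 0 t).symm ▸ hw01 t
  map_zero := intervalIntegral.integral_same

/-- A continuously differentiable minorant of the positive part `t ↦ max t 0`, within distance
`δ` of it. -/
def softPos (δ t : ℝ) : ℝ := ∫ s in 0..t, max 0 (min (s / δ) 1)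

variable {δ : ℝ}

theorem hasDerivAt_softPos (δ t : ℝ) : HasDerivAt (softPos δ) (max 0 (min (t / δ) 1)) t :=
  (show Continuous fun s : ℝ => max 0 (min (s / δ) 1) by fun_prop).integral_hasStrictDerivAt 0 t
    |>.hasDerivAt

theorem smoothContraction_softPos (δ : ℝ) : SmoothContraction (softPos δ) :=
  smoothContraction_integral (by fun_prop) fun _ =>
    ⟨le_max_left _ _, max_le zero_le_one (min_le_right _ _)⟩

theorem softPos_of_nonpos (hδ : 0 < δ) {t : ℝ} (ht : t ≤ 0) : softPos δ t = 0 := by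
  refine intervalIntegral.integral_zero_ae (Eventually.of_forall fun s hs => ?_)
  rw [uIoc_of_ge ht] at hs
  exact max_eq_left ((min_le_left _ _).trans (div_nonpos_of_nonpos_of_nonneg hs.2 hδ.le))

theorem softPos_nonneg (hδ : 0 < δ) (t : ℝ) : 0 ≤ softPos δ t := by
  rcases le_total t 0 with ht | ht
  · exact (softPos_of_nonpos hδ ht).ge
  · exact (smoothContraction_softPos δ).map_zero.ge.trans
      ((smoothContraction_softPos δ).monotone ht)

theorem sub_le_softPos (hδ : 0 < δ) (t : ℝ) : t - δ ≤ softPos δ t := by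
  have hanti : AntitoneOn (fun s => s - softPos δ s) (Ici δ) := by
    refine antitoneOn_of_deriv_nonpos (convex_Ici δ)
      (continuous_id.sub (smoothContraction_softPos δ).contDiff.continuous).continuousOn
      (fun s _ => ((hasDerivAt_id s).sub (hasDerivAt_softPos δ s)).differentiableAt
        |>.differentiableWithinAt) fun s hs => ?_
    rw [interior_Ici, mem_Ioi] at hs
    refine ((hasDerivAt_id s).sub (hasDerivAt_softPos δ s)).deriv.trans_le ?_
    rw [min_eq_right ((one_le_div hδ).2 hs.le), max_eq_right zero_le_one, sub_self]
  rcases le_total t δ with ht | ht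
  · exact (sub_nonpos.2 ht).trans (softPos_nonneg hδ t)
  · have := hanti self_mem_Ici ht ht
    linarith [softPos_nonneg hδ δ]

/-- A continuously differentiable contraction whose fixed points are those of the truncation
`t ↦ max 0 (min t 1)`. Its derivative is `1` on `[0, 1]` and vanishes off `[-1, 2]`. -/
def softClamp (t : ℝ) : ℝ := ∫ s in 0..t, max 0 (min 1 (min (1 + s) (2 - s)))

theorem smoothContraction_softClamp : SmoothContraction softClamp :=
  smoothContraction_integral (by fun_prop) fun _ =>
    ⟨le_max_left _ _, max_le zero_le_one (min_le_left _ _)⟩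

theorem softClamp_one : softClamp 1 = 1 := by
  have hweight : ∀ s ∈ uIcc (0 : ℝ) 1, max 0 (min 1 (min (1 + s) (2 - s))) = 1 := fun s hs => by
    rw [uIcc_of_le zero_le_one] at hs
    rw [min_eq_left (le_min (by linarith [hs.1]) (by linarith [hs.2])), max_eq_right zero_le_one]
  rw [softClamp, intervalIntegral.integral_congr hweight]
  simp

theorem strictMonoOn_sub_softClamp {s : Set ℝ} (hs : Convex ℝ s)
    (h : ∀ t ∈ interior s, t < 0 ∨ 1 < t) : StrictMonoOn (fun t => t - softClamp t) s := by
  have hderiv : ∀ t, HasDerivAt (fun t => t - softClamp t)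
      (1 - max 0 (min 1 (min (1 + t) (2 - t)))) t := fun t =>
    (hasDerivAt_id t).sub ((show Continuous fun s : ℝ => max 0 (min 1 (min (1 + s) (2 - s))) by
      fun_prop).integral_hasStrictDerivAt 0 t).hasDerivAt
  refine strictMonoOn_of_deriv_pos hs (fun t _ => (hderiv t).continuousAt.continuousWithinAt)
    fun t ht => ?_
  rw [(hderiv t).deriv, sub_pos]
  refine max_lt one_pos (min_lt_of_right_lt (min_lt_iff.2 ((h t ht).imp ?_ ?_))) <;>
    exact fun ht => by linarith

theorem mem_Icc_of_softClamp_eq_self {t : ℝ} (ht : softClamp t = t) : t ∈ Icc 0 1 := by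
  by_contra hmem
  rcases not_and_or.1 hmem with ht0 | ht1
  · have := strictMonoOn_sub_softClamp (convex_Iic 0) (fun s hs => .inl (by simpa using hs))
      (not_le.1 ht0).le self_mem_Iic (not_le.1 ht0)
    simp [ht, smoothContraction_softClamp.map_zero] at this
  · have := strictMonoOn_sub_softClamp (convex_Ici 1) (fun s hs => .inr (by simpa using hs))
      self_mem_Ici (not_le.1 ht1).le (not_le.1 ht1)
    simp [ht, softClamp_one] at this

end SoftTruncation

section Capacity

variable {N : ℕ} {p : ℝ≥0∞} {Ω : Set (Eucl N)} [Fact (1 ≤ p)]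

variable (p Ω) in
/-- The `p`-th root of the relative capacity. Unlike the capacity itself it is compared with norms
without passing to `p`-th powers, and it is countably subadditive as well. -/
def capRoot (A : Set (Eucl N)) : ℝ≥0∞ := ⨅ U ∈ admissible p Ω A, ‖U‖ₑ

theorem toReal_exponent_pos (hp : p ≠ ∞) : 0 < p.toReal :=
  ENNReal.toReal_pos (zero_lt_one.trans_le Fact.out).ne' hp

theorem relCap_eq_capRoot_rpow (hp : p ≠ ∞) (A : Set (Eucl N)) :
    relCap p Ω A = capRoot p Ω A ^ p.toReal := by
  rw [← ENNReal.orderIsoRpow_apply p.toReal (toReal_exponent_pos hp), capRoot]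
  simp_rw [OrderIso.map_iInf]
  rfl

theorem relCap_eq_zero_iff (hp : p ≠ ∞) {A : Set (Eucl N)} :
    relCap p Ω A = 0 ↔ capRoot p Ω A = 0 := by
  rw [relCap_eq_capRoot_rpow hp, ENNReal.rpow_eq_zero_iff_of_pos (toReal_exponent_pos hp)]

theorem capRoot_le_of_mem {A : Set (Eucl N)} {U : LpJet p Ω} (hU : U ∈ admissible p Ω A) :
    capRoot p Ω A ≤ ‖U‖ₑ := iInf₂_le U hU

theorem exists_admissible_lt {A : Set (Eucl N)} {c : ℝ≥0∞} (h : capRoot p Ω A < c) :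
    ∃ U ∈ admissible p Ω A, ‖U‖ₑ < c := by
  simpa only [capRoot, iInf_lt_iff, exists_prop] using h

theorem capRoot_mono {A B : Set (Eucl N)} (h : A ⊆ B) : capRoot p Ω A ≤ capRoot p Ω B :=
  le_iInf₂ fun _ ⟨hU, V, hV, hBV, hae⟩ => capRoot_le_of_mem ⟨hU, V, hV, h.trans hBV, hae⟩

theorem capRoot_eq_zero_of_subset {A B : Set (Eucl N)} (h : A ⊆ B) (hB : capRoot p Ω B = 0) :
    capRoot p Ω A = 0 :=
  le_antisymm ((capRoot_mono h).trans hB.le) zero_le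

theorem capRoot_empty : capRoot p Ω ∅ = 0 := by
  refine le_antisymm ((capRoot_le_of_mem (U := 0) ⟨(sobolevTildeSubmodule p Ω).zero_mem, ∅,
    isOpen_empty, subset_rfl, ?_⟩).trans_eq enorm_zero) zero_le
  simp

theorem ae_inter_of_ae {O : Set (Eucl N)} {P : Eucl N → Prop}
    (h : ∀ᵐ x ∂volume.restrict Ω, P x) : ∀ᵐ x ∂volume.restrict (O ∩ Ω), P x :=
  ae_mono (Measure.restrict_mono_set _ inter_subset_right) h

theorem exists_isOpen_capRoot_lt {A : Set (Eucl N)} {c : ℝ≥0∞} (h : capRoot p Ω A < c) :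
    ∃ V, IsOpen V ∧ A ⊆ V ∧ capRoot p Ω V < c := by
  obtain ⟨U, ⟨hU, V, hV, hAV, hae⟩, hlt⟩ := exists_admissible_lt h
  exact ⟨V, hV, hAV, (capRoot_le_of_mem ⟨hU, V, hV, subset_rfl, hae⟩).trans_lt hlt⟩

theorem exists_sobolevTilde_forall_sub_le {ι : Type*} (hΩ : IsOpen Ω) (hp : p ≠ ∞)
    {U : ι → LpJet p Ω} (hU : ∀ i, U i ∈ sobolevTilde p Ω) (hsum : Summable fun i => ‖U i‖)
    {δ : ℝ} (hδ : 0 < δ) :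
    ∃ G ∈ sobolevTilde p Ω, ‖G‖ ≤ ∑' i, ‖U i‖ ∧
      ∀ i, ∀ᵐ x ∂volume.restrict Ω, U i none x - δ ≤ G none x := by
  let F i := compJet (smoothContraction_softPos δ) (U i)
  have hFU : ∀ i, ‖F i‖ ≤ ‖U i‖ := fun i => norm_compJet_le hp _ _
  have hF : HasSum F (∑' i, F i) := (Summable.of_norm_bounded hsum hFU).hasSum
  have hF_nonneg : ∀ i, 0 ≤ F i none := fun i => by
    rw [← Lp.coeFn_nonneg]
    filter_upwards [coeFn_compJet_none (smoothContraction_softPos δ) (U i)] with x hx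
    rw [hx]
    exact softPos_nonneg hδ _
  have hF_none : HasSum (fun i => F i none) ((∑' i, F i) none) :=
    hF.mapL (PiLp.proj p (fun _ => Lp ℝ p (volume.restrict Ω)) none : LpJet p Ω →L[ℝ] _)
  refine ⟨∑' i, F i, (isClosed_sobolevTilde p Ω).mem_of_tendsto hF (Eventually.of_forall fun s =>
    (sobolevTildeSubmodule p Ω).sum_mem fun i _ => compJet_mem_sobolevTilde hΩ hp _ (hU i)),
    tsum_of_norm_bounded hsum.hasSum hFU, fun i => ?_⟩
  filter_upwards [coeFn_compJet_none (smoothContraction_softPos δ) (U i),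
    Lp.coeFn_le _ _ |>.2 (le_hasSum hF_none i fun j _ => hF_nonneg j)] with x hx hle
  exact (sub_le_softPos hδ _).trans (hx.ge.trans hle)

theorem le_of_forall_le_ofReal_inv_mul {a c : ℝ≥0∞}
    (h : ∀ δ ∈ Ioo (0 : ℝ) 1, c ≤ ENNReal.ofReal (1 - δ)⁻¹ * a) : c ≤ a := by
  have hlim : Tendsto (fun δ : ℝ => ENNReal.ofReal (1 - δ)⁻¹) (𝓝[>] 0) (𝓝 1) := by
    have : ContinuousAt (fun δ : ℝ => ENNReal.ofReal (1 - δ)⁻¹) 0 :=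
      ENNReal.continuous_ofReal.continuousAt.comp
        ((continuousAt_const.sub continuousAt_id).inv₀ (by simp))
    simpa using this.tendsto.mono_left nhdsWithin_le_nhds
  refine ge_of_tendsto (by simpa using ENNReal.Tendsto.mul_const hlim (b := a) (.inl one_ne_zero))
    ?_
  filter_upwards [Ioo_mem_nhdsGT zero_lt_one] with δ hδ using h δ hδ

theorem capRoot_le_tsum {ι : Type*} [Countable ι] (hΩ : IsOpen Ω) (hp : p ≠ ∞)
    {U : ι → LpJet p Ω} (hU : ∀ i, U i ∈ sobolevTilde p Ω) {O : Set (Eucl N)} (hO : IsOpen O)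
    (h : ∀ᵐ x ∂volume.restrict (O ∩ Ω), ∃ i, 1 ≤ U i none x) :
    capRoot p Ω O ≤ ∑' i, ‖U i‖ₑ := by
  by_cases htop : ∑' i, ‖U i‖ₑ = ∞
  · exact htop ▸ le_top
  have hsum : Summable fun i => ‖U i‖ := by simpa using ENNReal.summable_toReal htop
  refine le_of_forall_le_ofReal_inv_mul fun δ hδ => ?_
  have hδ1 : 0 < 1 - δ := sub_pos.2 hδ.2
  obtain ⟨G, hG, hGU, hle⟩ := exists_sobolevTilde_forall_sub_le hΩ hp hU hsum hδ.1
  have hadm : (1 - δ)⁻¹ • G ∈ admissible p Ω O := by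
    refine ⟨(sobolevTildeSubmodule p Ω).smul_mem _ hG, O, hO, subset_rfl, ?_⟩
    filter_upwards [h, ae_inter_of_ae (ae_all_iff.2 hle),
      ae_inter_of_ae (coeFn_smul_none (1 - δ)⁻¹ G)] with x ⟨i, hi⟩ hx hxG
    rw [hxG, ← div_eq_inv_mul, one_le_div hδ1]
    linarith [hx i]
  calc capRoot p Ω O ≤ ‖(1 - δ)⁻¹ • G‖ₑ := capRoot_le_of_mem hadm
    _ = ENNReal.ofReal (1 - δ)⁻¹ * ENNReal.ofReal ‖G‖ := by
        rw [enorm_smul, Real.enorm_of_nonneg (inv_nonneg.2 hδ1.le), ofReal_norm]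
    _ ≤ ENNReal.ofReal (1 - δ)⁻¹ * ENNReal.ofReal (∑' i, ‖U i‖) := by gcongr
    _ = ENNReal.ofReal (1 - δ)⁻¹ * ∑' i, ‖U i‖ₑ := by
        rw [ENNReal.ofReal_tsum_of_nonneg (fun _ => norm_nonneg _) hsum]
        simp only [ofReal_norm]

theorem capRoot_iUnion_le {ι : Type*} [Countable ι] (hΩ : IsOpen Ω) (hp : p ≠ ∞)
    (A : ι → Set (Eucl N)) : capRoot p Ω (⋃ i, A i) ≤ ∑' i, capRoot p Ω (A i) := by
  by_cases htop : ∑' i, capRoot p Ω (A i) = ∞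
  · exact htop ▸ le_top
  refine ENNReal.le_of_forall_pos_le_add fun ε hε _ => ?_
  obtain ⟨d, hd, hdε⟩ := ENNReal.exists_pos_sum_of_countable (ENNReal.coe_ne_zero.2 hε.ne') ι
  have hex : ∀ i, ∃ U ∈ admissible p Ω (A i), ‖U‖ₑ < capRoot p Ω (A i) + d i := fun i =>
    exists_admissible_lt (ENNReal.lt_add_right (ENNReal.ne_top_of_tsum_ne_top htop i)
      (ENNReal.coe_ne_zero.2 (hd i).ne'))
  choose U hU hUlt using hex
  choose hUt V hV hAV hae using hU
  calc capRoot p Ω (⋃ i, A i) ≤ capRoot p Ω (⋃ i, V i) := capRoot_mono (iUnion_mono hAV)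
    _ ≤ ∑' i, ‖U i‖ₑ := by
        refine capRoot_le_tsum hΩ hp hUt (isOpen_iUnion hV) ?_
        rw [iUnion_inter, ae_restrict_iUnion_iff]
        intro i
        filter_upwards [hae i] with x hx using ⟨i, hx⟩
    _ ≤ ∑' i, (capRoot p Ω (A i) + d i) := ENNReal.tsum_le_tsum fun i => (hUlt i).le
    _ = ∑' i, capRoot p Ω (A i) + ∑' i, (d i : ℝ≥0∞) := ENNReal.tsum_add
    _ ≤ ∑' i, capRoot p Ω (A i) + ε := by gcongr

theorem capRoot_union_le (hΩ : IsOpen Ω) (hp : p ≠ ∞) (A B : Set (Eucl N)) :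
    capRoot p Ω (A ∪ B) ≤ capRoot p Ω A + capRoot p Ω B := by
  simpa [union_eq_iUnion, add_comm] using capRoot_iUnion_le hΩ hp fun b : Bool => cond b A B

theorem capRoot_union_eq_zero (hΩ : IsOpen Ω) (hp : p ≠ ∞) {A B : Set (Eucl N)}
    (hA : capRoot p Ω A = 0) (hB : capRoot p Ω B = 0) : capRoot p Ω (A ∪ B) = 0 :=
  le_antisymm ((capRoot_union_le hΩ hp A B).trans_eq (by rw [hA, hB, add_zero])) zero_le

theorem capRoot_le_enorm_add (hΩ : IsOpen Ω) (hp : p ≠ ∞) {U : LpJet p Ω}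
    (hU : U ∈ sobolevTilde p Ω) {O V : Set (Eucl N)} (hO : IsOpen O)
    (h : ∀ᵐ x ∂volume.restrict (O ∩ Ω), 1 ≤ U none x ∨ x ∈ V) :
    capRoot p Ω O ≤ ‖U‖ₑ + capRoot p Ω V := by
  suffices hW : ∀ W ∈ admissible p Ω V, capRoot p Ω O ≤ ‖U‖ₑ + ‖W‖ₑ by
    rw [capRoot.eq_def p Ω V]
    simpa only [ENNReal.add_iInf, le_iInf_iff] using hW
  refine fun W ⟨hW, V', hV', hVV', hae⟩ => ?_
  rw [← Measure.restrict_restrict hV'.measurableSet, ae_restrict_iff' hV'.measurableSet] at hae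
  have hle := capRoot_le_tsum hΩ hp (U := fun b : Bool => cond b W U)
    (Bool.forall_bool.2 ⟨hU, hW⟩) hO (by
      filter_upwards [h, ae_inter_of_ae hae] with x hx hWx
      exact Bool.exists_bool.2 (hx.imp_right fun hxV => hWx (hVV' hxV)))
  simpa [add_comm] using hle

theorem capRoot_le_of_ae_mem (hΩ : IsOpen Ω) (hp : p ≠ ∞) {O V : Set (Eucl N)} (hO : IsOpen O)
    (h : ∀ᵐ x ∂volume.restrict (O ∩ Ω), x ∈ V) : capRoot p Ω O ≤ capRoot p Ω V := by
  simpa using capRoot_le_enorm_add hΩ hp (sobolevTildeSubmodule p Ω).zero_mem hO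
    (h.mono fun _ => Or.inr)

end Capacity

section QuasiContinuity

variable {N : ℕ} {p : ℝ≥0∞} {Ω : Set (Eucl N)} [Fact (1 ≤ p)]

theorem qeOn_iff_capRoot (hp : p ≠ ∞) {S : Set (Eucl N)} {P : Eucl N → Prop} :
    QEOn p Ω S P ↔ capRoot p Ω {x ∈ S | ¬ P x} = 0 := relCap_eq_zero_iff hp

theorem QEOn.mono (hp : p ≠ ∞) {S S' : Set (Eucl N)} {P P' : Eucl N → Prop}
    (h : QEOn p Ω S P) (hS : S' ⊆ S) (hP : ∀ x ∈ S', P x → P' x) : QEOn p Ω S' P' := by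
  rw [qeOn_iff_capRoot hp] at h ⊢
  refine capRoot_eq_zero_of_subset ?_ h
  exact fun x hx => ⟨hS hx.1, fun hPx => hx.2 (hP x hx.1 hPx)⟩

theorem QEOn.and (hΩ : IsOpen Ω) (hp : p ≠ ∞) {S : Set (Eucl N)} {P Q : Eucl N → Prop}
    (hP : QEOn p Ω S P) (hQ : QEOn p Ω S Q) : QEOn p Ω S (fun x => P x ∧ Q x) := by
  rw [qeOn_iff_capRoot hp] at hP hQ ⊢
  refine capRoot_eq_zero_of_subset (fun x hx => ?_) (capRoot_union_eq_zero hΩ hp hP hQ)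
  exact (not_and_or.1 hx.2).imp (⟨hx.1, ·⟩) (⟨hx.1, ·⟩)

theorem isQuasiCont_iff_capRoot (hp : p ≠ ∞) {u : Eucl N → ℝ} :
    IsQuasiCont p Ω u ↔ ∀ ε : ℝ≥0∞, 0 < ε → ∃ V, IsOpen V ∧ capRoot p Ω (V ∩ closure Ω) < ε ∧
      ContinuousOn u (closure Ω \ V) := by
  have hpr := toReal_exponent_pos hp
  simp only [IsQuasiCont, relCap_eq_capRoot_rpow hp]
  constructor
  · intro h ε hε
    simpa only [ENNReal.rpow_lt_rpow_iff hpr] using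
      h (ε ^ p.toReal) (ENNReal.rpow_pos_of_nonneg hε hpr.le)
  · intro h ε hε
    simpa only [ENNReal.lt_rpow_inv_iff hpr] using
      h (ε ^ p.toReal⁻¹) (ENNReal.rpow_pos_of_nonneg hε (inv_pos.2 hpr).le)

theorem isQuasiCont_of_continuousOn (hp : p ≠ ∞) {u : Eucl N → ℝ}
    (hu : ContinuousOn u (closure Ω)) : IsQuasiCont p Ω u := by
  rw [isQuasiCont_iff_capRoot hp]
  exact fun ε hε => ⟨∅, isOpen_empty, by simpa [capRoot_empty] using hε, by simpa using hu⟩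

theorem IsQuasiCont.comp {u : Eucl N → ℝ} (hu : IsQuasiCont p Ω u) {T : ℝ → ℝ}
    (hT : Continuous T) : IsQuasiCont p Ω (fun x => T (u x)) := fun ε hε => by
  obtain ⟨V, hV, hVε, huV⟩ := hu ε hε
  exact ⟨V, hV, hVε, hT.comp_continuousOn huV⟩

theorem IsQuasiCont.add (hΩ : IsOpen Ω) (hp : p ≠ ∞) {u v : Eucl N → ℝ}
    (hu : IsQuasiCont p Ω u) (hv : IsQuasiCont p Ω v) :
    IsQuasiCont p Ω (fun x => u x + v x) := by
  rw [isQuasiCont_iff_capRoot hp] at *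
  intro ε hε
  obtain ⟨V, hV, hVε, huV⟩ := hu _ (ENNReal.half_pos hε.ne')
  obtain ⟨W, hW, hWε, hvW⟩ := hv _ (ENNReal.half_pos hε.ne')
  refine ⟨V ∪ W, hV.union hW, ?_, (huV.mono (sdiff_subset_sdiff_right subset_union_left)).add
    (hvW.mono (sdiff_subset_sdiff_right subset_union_right))⟩
  rw [union_inter_distrib_right, ← ENNReal.add_halves ε]
  exact (capRoot_union_le hΩ hp _ _).trans_lt (ENNReal.add_lt_add hVε hWε)

theorem IsQuasiCont.sub (hΩ : IsOpen Ω) (hp : p ≠ ∞) {u v : Eucl N → ℝ}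
    (hu : IsQuasiCont p Ω u) (hv : IsQuasiCont p Ω v) :
    IsQuasiCont p Ω (fun x => u x - v x) := by
  simpa only [sub_eq_add_neg] using hu.add hΩ hp (hv.comp continuous_neg)

theorem IsQuasiCont.exists_isOpen_preimage (hp : p ≠ ∞) {u : Eucl N → ℝ}
    (hu : IsQuasiCont p Ω u) {s : Set ℝ} (hs : IsOpen s) {ε : ℝ≥0∞} (hε : 0 < ε) :
    ∃ V o, IsOpen V ∧ IsOpen o ∧ capRoot p Ω V < ε ∧
      ∀ x ∈ closure Ω \ V, x ∈ o ↔ u x ∈ s := by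
  obtain ⟨G, -, hGε, hcont⟩ := (isQuasiCont_iff_capRoot hp).1 hu ε hε
  obtain ⟨V, hV, hGV, hVε⟩ := exists_isOpen_capRoot_lt hGε
  obtain ⟨o, ho, hou⟩ := continuousOn_iff'.1 hcont s hs
  refine ⟨V, o, hV, ho, hVε, fun x hx => ?_⟩
  have hxG : x ∈ closure Ω \ G := ⟨hx.1, fun hxG => hx.2 (hGV ⟨hxG, hx.1⟩)⟩
  simpa [hxG] using (Set.ext_iff.1 hou x).symm

theorem IsQuasiCont.qeOn_nonneg_of_ae (hΩ : IsOpen Ω) (hp : p ≠ ∞) {u : Eucl N → ℝ}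
    (hu : IsQuasiCont p Ω u) {O : Set (Eucl N)} (hO : IsOpen O)
    (h : ∀ᵐ x ∂volume.restrict (O ∩ Ω), 0 ≤ u x) :
    QEOn p Ω (O ∩ closure Ω) (fun x => 0 ≤ u x) := by
  rw [qeOn_iff_capRoot hp]
  refine le_antisymm (le_of_forall_gt fun ε hε => ?_) zero_le
  obtain ⟨V, o, hV, ho, hVε, hou⟩ := hu.exists_isOpen_preimage hp isOpen_Iio hε
  have hopen : IsOpen (O ∩ o ∪ V) := (hO.inter ho).union hV
  have hsub : {x ∈ O ∩ closure Ω | ¬ 0 ≤ u x} ⊆ O ∩ o ∪ V := fun x hx =>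
    or_iff_not_imp_right.2 fun hxV => ⟨hx.1.1, (hou x ⟨hx.1.2, hxV⟩).2 (not_le.1 hx.2)⟩
  refine ((capRoot_mono hsub).trans (capRoot_le_of_ae_mem hΩ hp hopen ?_)).trans_lt hVε
  rw [ae_restrict_iff' (hO.inter hΩ).measurableSet] at h
  rw [ae_restrict_iff' (hopen.inter hΩ).measurableSet]
  filter_upwards [h] with x hx hxO
  by_contra hxV
  obtain ⟨hxO', hxo⟩ := hxO.1.resolve_right hxV
  exact (hx ⟨hxO', hxO.2⟩).not_gt ((hou x ⟨subset_closure hxO.2, hxV⟩).1 hxo)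

theorem IsQuasiCont.qeOn_le_of_ae (hΩ : IsOpen Ω) (hp : p ≠ ∞) {u v : Eucl N → ℝ}
    (hu : IsQuasiCont p Ω u) (hv : IsQuasiCont p Ω v) {O : Set (Eucl N)} (hO : IsOpen O)
    (h : ∀ᵐ x ∂volume.restrict (O ∩ Ω), u x ≤ v x) :
    QEOn p Ω (O ∩ closure Ω) (fun x => u x ≤ v x) := by
  simpa only [sub_nonneg] using (hv.sub hΩ hp hu).qeOn_nonneg_of_ae hΩ hp hO
    (h.mono fun _ hx => sub_nonneg.2 hx)

theorem IsQuasiCont.qeOn_closure_le_of_ae (hΩ : IsOpen Ω) (hp : p ≠ ∞) {u v : Eucl N → ℝ}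
    (hu : IsQuasiCont p Ω u) (hv : IsQuasiCont p Ω v)
    (h : ∀ᵐ x ∂volume.restrict Ω, u x ≤ v x) :
    QEOn p Ω (closure Ω) (fun x => u x ≤ v x) := by
  simpa only [univ_inter] using hu.qeOn_le_of_ae hΩ hp hv isOpen_univ (by rwa [univ_inter])

theorem IsQuasiCont.qeOn_closure_eq_of_ae (hΩ : IsOpen Ω) (hp : p ≠ ∞) {u v : Eucl N → ℝ}
    (hu : IsQuasiCont p Ω u) (hv : IsQuasiCont p Ω v) (h : u =ᵐ[volume.restrict Ω] v) :
    QEOn p Ω (closure Ω) (fun x => u x = v x) :=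
  ((hu.qeOn_closure_le_of_ae hΩ hp hv h.le).and hΩ hp
    (hv.qeOn_closure_le_of_ae hΩ hp hu h.symm.le)).mono hp subset_rfl
    fun _ _ hx => le_antisymm hx.1 hx.2

theorem capRoot_setOf_one_le (hΩ : IsOpen Ω) (hp : p ≠ ∞) {U : LpJet p Ω}
    (hU : U ∈ sobolevTilde p Ω) {u : Eucl N → ℝ} (hu : IsQuasiCont p Ω u)
    (hUu : U none =ᵐ[volume.restrict Ω] u) : capRoot p Ω {x ∈ closure Ω | 1 ≤ u x} ≤ ‖U‖ₑ := by
  refine le_of_forall_le_ofReal_inv_mul fun δ hδ =>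
    ENNReal.le_of_forall_pos_le_add fun ε hε _ => ?_
  have hδ1 : 0 < 1 - δ := sub_pos.2 hδ.2
  obtain ⟨V, o, hV, ho, hVε, hou⟩ :=
    hu.exists_isOpen_preimage hp (isOpen_Ioi (a := 1 - δ)) (ENNReal.coe_pos.2 hε)
  have hsub : {x ∈ closure Ω | 1 ≤ u x} ⊆ o ∪ V := fun x hx =>
    or_iff_not_imp_right.2 fun hxV =>
      (hou x ⟨hx.1, hxV⟩).2 (((sub_lt_self_iff 1).2 hδ.1).trans_le hx.2)
  have hae : ∀ᵐ x ∂volume.restrict ((o ∪ V) ∩ Ω), 1 ≤ ((1 - δ)⁻¹ • U) none x ∨ x ∈ V := by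
    filter_upwards [ae_inter_of_ae (coeFn_smul_none (1 - δ)⁻¹ U), ae_inter_of_ae hUu,
      ae_restrict_mem ((ho.union hV).inter hΩ).measurableSet] with x hx hxu hxo
    refine or_iff_not_imp_right.2 fun hxV => ?_
    rw [hx, hxu, ← div_eq_inv_mul, one_le_div hδ1]
    exact ((hou x ⟨subset_closure hxo.2, hxV⟩).1 (hxo.1.resolve_right hxV)).le
  calc capRoot p Ω {x ∈ closure Ω | 1 ≤ u x} ≤ capRoot p Ω (o ∪ V) := capRoot_mono hsub
    _ ≤ ‖(1 - δ)⁻¹ • U‖ₑ + capRoot p Ω V := capRoot_le_enorm_add hΩ hp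
        ((sobolevTildeSubmodule p Ω).smul_mem _ hU) (ho.union hV) hae
    _ ≤ ENNReal.ofReal (1 - δ)⁻¹ * ‖U‖ₑ + ε := by
        rw [enorm_smul, Real.enorm_of_nonneg (inv_nonneg.2 hδ1.le)]
        gcongr

theorem capRoot_le_enorm_of_qeOn (hΩ : IsOpen Ω) (hp : p ≠ ∞) {U : LpJet p Ω}
    (hU : U ∈ sobolevTilde p Ω) {u : Eucl N → ℝ} (hu : IsQuasiCont p Ω u)
    (hUu : U none =ᵐ[volume.restrict Ω] u) {A : Set (Eucl N)} (hA : A ⊆ closure Ω)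
    (h : QEOn p Ω A (fun x => 1 ≤ u x)) : capRoot p Ω A ≤ ‖U‖ₑ := by
  rw [qeOn_iff_capRoot hp] at h
  have hsub : A ⊆ {x ∈ closure Ω | 1 ≤ u x} ∪ {x ∈ A | ¬ 1 ≤ u x} := fun x hx =>
    (em (1 ≤ u x)).imp (⟨hA hx, ·⟩) (⟨hx, ·⟩)
  refine (capRoot_mono hsub).trans ((capRoot_union_le hΩ hp _ _).trans ?_)
  rw [h, add_zero]
  exact capRoot_setOf_one_le hΩ hp hU hu hUu

theorem capRoot_setOf_le (hΩ : IsOpen Ω) (hp : p ≠ ∞) {U : LpJet p Ω}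
    (hU : U ∈ sobolevTilde p Ω) {u : Eucl N → ℝ} (hu : IsQuasiCont p Ω u)
    (hUu : U none =ᵐ[volume.restrict Ω] u) {c : ℝ} (hc : 0 < c) :
    capRoot p Ω {x ∈ closure Ω | c ≤ u x} ≤ ENNReal.ofReal (‖U‖ / c) := by
  have hle := capRoot_setOf_one_le hΩ hp ((sobolevTildeSubmodule p Ω).smul_mem c⁻¹ hU)
    (hu.comp (continuous_const_mul c⁻¹)) (by
      filter_upwards [coeFn_smul_none c⁻¹ U, hUu] with x hx hxu
      rw [hx, hxu])
  simpa only [← div_eq_inv_mul, one_le_div hc, ← ofReal_norm, norm_smul, norm_inv,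
    Real.norm_of_nonneg hc.le] using hle

theorem capRoot_setOf_le_abs (hΩ : IsOpen Ω) (hp : p ≠ ∞) {U : LpJet p Ω}
    (hU : U ∈ sobolevTilde p Ω) {u : Eucl N → ℝ} (hu : IsQuasiCont p Ω u)
    (hUu : U none =ᵐ[volume.restrict Ω] u) {c : ℝ} (hc : 0 < c) :
    capRoot p Ω {x ∈ closure Ω | c ≤ |u x|} ≤ ENNReal.ofReal (2 * ‖U‖ / c) := by
  have hneg : (-U) none =ᵐ[volume.restrict Ω] fun x => -u x := (Lp.coeFn_neg (U none)).trans hUu.neg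
  have hsub : {x ∈ closure Ω | c ≤ |u x|} ⊆
      {x ∈ closure Ω | c ≤ u x} ∪ {x ∈ closure Ω | c ≤ -u x} := fun x hx =>
    (le_abs.1 hx.2).imp (⟨hx.1, ·⟩) (⟨hx.1, ·⟩)
  calc capRoot p Ω {x ∈ closure Ω | c ≤ |u x|}
      ≤ capRoot p Ω {x ∈ closure Ω | c ≤ u x} + capRoot p Ω {x ∈ closure Ω | c ≤ -u x} :=
        (capRoot_mono hsub).trans (capRoot_union_le hΩ hp _ _)
    _ ≤ ENNReal.ofReal (‖U‖ / c) + ENNReal.ofReal (‖-U‖ / c) := by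
        gcongr
        · exact capRoot_setOf_le hΩ hp hU hu hUu hc
        · exact capRoot_setOf_le hΩ hp ((sobolevTildeSubmodule p Ω).neg_mem hU)
            (hu.comp continuous_neg) hneg hc
    _ = ENNReal.ofReal (2 * ‖U‖ / c) := by
        rw [norm_neg, ← ENNReal.ofReal_add (by positivity) (by positivity)]
        ring_nf

theorem exists_isOpen_capRoot_lt_of_tsum_ne_top (hΩ : IsOpen Ω) (hp : p ≠ ∞)
    {A : ℕ → Set (Eucl N)} (hA : ∑' k, capRoot p Ω (A k) ≠ ∞) {ε : ℝ≥0∞} (hε : 0 < ε) :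
    ∃ m V, IsOpen V ∧ capRoot p Ω V < ε ∧ ∀ k ≥ m, A k ⊆ V := by
  obtain ⟨m, hm⟩ := ((ENNReal.tendsto_sum_nat_add _ hA).eventually (gt_mem_nhds hε)).exists
  obtain ⟨V, hV, hAV, hVε⟩ := exists_isOpen_capRoot_lt
    ((capRoot_iUnion_le hΩ hp fun k => A (k + m)).trans_lt hm)
  refine ⟨m, V, hV, hVε, fun k hk => ?_⟩
  simpa only [Nat.sub_add_cancel hk] using (iUnion_subset_iff.1 hAV) (k - m)

theorem continuousOn_limUnder_of_dist_le {X E : Type*} [TopologicalSpace X] [MetricSpace E]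
    [CompleteSpace E] [Nonempty E] {f : ℕ → X → E} {S : Set X} {d : ℕ → ℝ} (hd : Summable d)
    {m : ℕ} (hf : ∀ k, ContinuousOn (f k) S)
    (hdist : ∀ x ∈ S, ∀ k ≥ m, dist (f k x) (f (k + 1) x) ≤ d k) :
    ContinuousOn (fun x => limUnder atTop fun k => f k x) S := by
  have hlim : ∀ x ∈ S, Tendsto (fun k => f k x) atTop (𝓝 (limUnder atTop fun k => f k x)) := by
    intro x hx
    refine CauchySeq.tendsto_limUnder ?_
    rw [← cauchySeq_shift m]
    refine cauchySeq_of_dist_le_of_summable (fun k => d (k + m)) (fun k => ?_)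
      ((summable_nat_add_iff m).2 hd)
    simpa only [Nat.succ_eq_add_one, add_right_comm] using hdist x hx (k + m) (Nat.le_add_left m k)
  have hunif : TendstoUniformlyOn f (fun x => limUnder atTop fun k => f k x) atTop S := by
    rw [Metric.tendstoUniformlyOn_iff]
    intro η hη
    filter_upwards [eventually_ge_atTop m,
      (tendsto_sum_nat_add d).eventually (gt_mem_nhds hη)] with k hk hkη x hx
    rw [dist_comm]
    refine (dist_le_tsum_of_dist_le_of_tendsto₀ (f := fun j => f (j + k) x) (fun j => d (j + k))
      (fun j => ?_) ((summable_nat_add_iff k).2 hd)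
      ((tendsto_add_atTop_iff_nat k).2 (hlim x hx)) |>.trans_eq' (by simp)).trans_lt hkη
    simpa only [Nat.succ_eq_add_one, add_right_comm] using
      hdist x hx (j + k) (hk.trans (Nat.le_add_left k j))
  exact hunif.continuousOn (Frequently.of_forall hf)

theorem capRoot_setOf_le_abs_sub_le (hΩ : IsOpen Ω) (hp : p ≠ ∞) {F G : LpJet p Ω}
    (hF : F ∈ sobolevTilde p Ω) (hG : G ∈ sobolevTilde p Ω) {f g : Eucl N → ℝ}
    (hf : ContinuousOn f (closure Ω)) (hg : ContinuousOn g (closure Ω))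
    (hFf : F none =ᵐ[volume.restrict Ω] f) (hGg : G none =ᵐ[volume.restrict Ω] g)
    {c : ℝ} (hc : 0 < c) :
    capRoot p Ω {x ∈ closure Ω | c ≤ |f x - g x|} ≤ ENNReal.ofReal (2 * dist F G / c) := by
  rw [dist_eq_norm]
  exact capRoot_setOf_le_abs hΩ hp ((sobolevTildeSubmodule p Ω).sub_mem hF hG)
    (isQuasiCont_of_continuousOn hp (hf.sub hg)) ((coeFn_sub_none F G).trans (hFf.sub hGg)) hc

theorem exists_isQuasiCont (hΩ : IsOpen Ω) (hp : p ≠ ∞) {U : LpJet p Ω}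
    (hU : U ∈ sobolevTilde p Ω) :
    ∃ u, IsQuasiCont p Ω u ∧ U none =ᵐ[volume.restrict Ω] u := by
  obtain ⟨F, hF, hFU, hlim⟩ := exists_seq_sobolevCc_ae_tendsto hU
    (δ := fun k => (1 / 4 : ℝ) ^ k) fun k => by positivity
  have hFt : ∀ k, F k ∈ sobolevTilde p Ω := fun k => ⟨subset_closure (hF k), (hF k).1⟩
  choose _ f hf hFf using hF
  refine ⟨fun x => limUnder atTop fun k => f k x, ?_, ?_⟩
  · let J (k : ℕ) : Set (Eucl N) := {x ∈ closure Ω | (1 / 2) ^ k ≤ |f k x - f (k + 1) x|}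
    have hJ : ∑' k, capRoot p Ω (J k) ≠ ∞ := by
      refine ne_top_of_le_ne_top (summable_geometric_two.mul_left 4).tsum_ofReal_ne_top
        (ENNReal.tsum_le_tsum fun k => (capRoot_setOf_le_abs_sub_le hΩ hp (hFt k) (hFt (k + 1))
          (hf k).1 (hf (k + 1)).1 (hFf k) (hFf (k + 1)) (by positivity)).trans ?_)
      gcongr
      calc 2 * dist (F k) (F (k + 1)) / (1 / 2) ^ k
          ≤ 2 * ((1 / 4) ^ k + (1 / 4) ^ k) / (1 / 2) ^ k := by
            gcongr
            exact (dist_triangle_right _ _ U).trans (add_le_add (hFU k) ((hFU (k + 1)).trans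
              (pow_le_pow_of_le_one (by norm_num) (by norm_num) k.le_succ)))
        _ = 4 * (1 / 2) ^ k := by
            rw [show (1 / 4 : ℝ) = 1 / 2 * (1 / 2) by norm_num, mul_pow]
            field_simp
            norm_num
    rw [isQuasiCont_iff_capRoot hp]
    intro ε hε
    obtain ⟨m, V, hV, hVε, hJV⟩ := exists_isOpen_capRoot_lt_of_tsum_ne_top hΩ hp hJ hε
    refine ⟨V, hV, (capRoot_mono inter_subset_left).trans_lt hVε,
      continuousOn_limUnder_of_dist_le summable_geometric_two (m := m)
        (fun k => (hf k).1.mono sdiff_subset) fun x hx k hk => ?_⟩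
    exact (not_le.1 fun hle => hx.2 (hJV k hk ⟨hx.1, hle⟩)).le
  · filter_upwards [hlim, ae_all_iff.2 hFf] with x hx hxf
    exact (hx.congr hxf).limUnder_eq.symm

end QuasiContinuity

section MidpointConvexity

/-- The defect of convexity of `t ↦ |t| ^ q` at the midpoint of `a` and `b`. -/
def midGap (q a b : ℝ) : ℝ := (|a| ^ q + |b| ^ q) / 2 - |(a + b) / 2| ^ q

variable {q : ℝ}

theorem midGap_pos (hq : 1 < q) {a b : ℝ} (hab : a ≠ b) : 0 < midGap q a b := by
  have hq0 : 0 < q := one_pos.trans hq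
  rw [midGap, sub_pos]
  by_cases habs : |a| = |b|
  · obtain rfl : a = -b := (abs_eq_abs.1 habs).resolve_left hab
    have hb : b ≠ 0 := fun hb => hab (by rw [hb, neg_zero])
    simpa [Real.zero_rpow hq0.ne'] using Real.rpow_pos_of_pos (abs_pos.2 hb) q
  · calc |(a + b) / 2| ^ q ≤ (1 / 2 * |a| + 1 / 2 * |b|) ^ q := by
          refine Real.rpow_le_rpow (abs_nonneg _) ?_ hq0.le
          rw [abs_div, abs_two]
          linarith [abs_add_le a b]
      _ < 1 / 2 * |a| ^ q + 1 / 2 * |b| ^ q :=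
          (strictConvexOn_rpow hq).2 (abs_nonneg a) (abs_nonneg b) habs one_half_pos one_half_pos
            (add_halves 1)
      _ = (|a| ^ q + |b| ^ q) / 2 := by ring

theorem midGap_self (q a : ℝ) : midGap q a a = 0 := by
  simp [midGap]

theorem midGap_nonneg (hq : 1 < q) (a b : ℝ) : 0 ≤ midGap q a b := by
  rcases eq_or_ne a b with rfl | hab
  · exact (midGap_self q a).ge
  · exact (midGap_pos hq hab).le

theorem continuous_midGap (hq : 0 ≤ q) : Continuous fun z : ℝ × ℝ => midGap q z.1 z.2 := by
  unfold midGap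
  fun_prop (disch := exact fun _ => Or.inr hq)

theorem midGap_mul_mul {s : ℝ} (hs : 0 ≤ s) (a b : ℝ) :
    midGap q (s * a) (s * b) = s ^ q * midGap q a b := by
  have hmid : (s * a + s * b) / 2 = s * ((a + b) / 2) := by ring
  simp only [midGap, hmid, abs_mul, abs_of_nonneg hs, Real.mul_rpow hs (abs_nonneg _)]
  ring

theorem exists_forall_le_mul_of_isCompact {X : Type*} [TopologicalSpace X] {K : Set X}
    (hK : IsCompact K) {f h : X → ℝ} (hf : Continuous f) (hh : Continuous h)
    (hh0 : ∀ x ∈ K, 0 ≤ h x) (hfh : ∀ x ∈ K, h x = 0 → f x < 0) :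
    ∃ C, 0 < C ∧ ∀ x ∈ K, f x ≤ C * h x := by
  have hK' : IsCompact (K ∩ {x | 0 ≤ f x}) := hK.inter_right (isClosed_le continuous_const hf)
  obtain ⟨δ, hδ, hδh⟩ := hK'.exists_forall_le' hh.continuousOn (a := 0) fun x hx =>
    (hh0 x hx.1).lt_of_ne fun h0 => (hfh x hx.1 h0.symm).not_ge hx.2
  obtain ⟨M, hM⟩ := (hK.image hf).bddAbove
  refine ⟨max M 1 / δ, by positivity, fun x hx => ?_⟩
  rcases le_or_gt 0 (f x) with hfx | hfx
  · calc f x ≤ max M 1 := (hM (mem_image_of_mem f hx)).trans (le_max_left _ _)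
      _ = max M 1 / δ * δ := (div_mul_cancel₀ _ hδ.ne').symm
      _ ≤ max M 1 / δ * h x := by
          gcongr
          exact hδh x ⟨hx, hfx⟩
  · exact hfx.le.trans (mul_nonneg (by positivity) (hh0 x hx))

theorem exists_abs_sub_rpow_le (hq : 1 < q) {ε : ℝ} (hε : 0 < ε) :
    ∃ C, 0 < C ∧ ∀ a b : ℝ, |a - b| ^ q ≤ ε * (|a| ^ q + |b| ^ q) + C * midGap q a b := by
  -- Both sides are homogeneous of degree `q`, so compactness of the unit sphere gives `C`.
  have hq0 : 0 < q := one_pos.trans hq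
  have hpow : Continuous fun t : ℝ => |t| ^ q := continuous_abs.rpow_const fun _ => .inr hq0.le
  obtain ⟨C, hC, hle⟩ := exists_forall_le_mul_of_isCompact (isCompact_sphere (0 : ℝ × ℝ) 1)
    (f := fun z => |z.1 - z.2| ^ q - ε * (|z.1| ^ q + |z.2| ^ q))
    ((hpow.comp (continuous_fst.sub continuous_snd)).sub (((hpow.comp continuous_fst).add
      (hpow.comp continuous_snd)).const_mul ε)) (continuous_midGap hq0.le)
    (fun z _ => midGap_nonneg hq z.1 z.2) (by
      rintro ⟨a, b⟩ hz h0
      obtain rfl : a = b := by_contra fun hab => (midGap_pos hq hab).ne' h0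
      have ha : a ≠ 0 := by
        rintro rfl
        simp at hz
      have hpos := Real.rpow_pos_of_pos (abs_pos.2 ha) q
      simp only [sub_self, abs_zero, Real.zero_rpow hq0.ne', zero_sub, Left.neg_neg_iff]
      positivity)
  refine ⟨C, hC, fun a b => ?_⟩
  rcases eq_or_ne (a, b) (0 : ℝ × ℝ) with h0 | h0
  · obtain ⟨rfl, rfl⟩ := Prod.mk_eq_zero.1 h0
    simp [midGap_self, Real.zero_rpow hq0.ne']
  · have hs : 0 < ‖(a, b)‖⁻¹ := inv_pos.2 (norm_pos_iff.2 h0)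
    have hscaled := hle (‖(a, b)‖⁻¹ • (a, b)) (by
      rw [mem_sphere_zero_iff_norm, norm_smul_of_nonneg hs.le]
      exact inv_mul_cancel₀ (norm_pos_iff.2 h0).ne')
    simp only [Prod.smul_mk, smul_eq_mul, midGap_mul_mul hs.le, ← mul_sub, abs_mul,
      abs_of_pos hs, Real.mul_rpow hs.le (abs_nonneg _)] at hscaled
    refine le_of_mul_le_mul_left ?_ (Real.rpow_pos_of_pos hs q)
    linarith

end MidpointConvexity

section UniformConvexity

variable {ι α : Type*} [Fintype ι] [MeasurableSpace α] {μ : Measure α} {p : ℝ≥0∞} [Fact (1 ≤ p)]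

theorem norm_rpow_eq_integral (hp : p ≠ ∞) (f : Lp ℝ p μ) :
    ‖f‖ ^ p.toReal = ∫ x, |f x| ^ p.toReal ∂μ := by
  have hpr := toReal_exponent_pos hp
  have hnonneg : 0 ≤ ∫ x, ‖f x‖ ^ p.toReal ∂μ := integral_nonneg fun x => by positivity
  rw [Lp.norm_def, (Lp.memLp f).eLpNorm_eq_integral_rpow_norm
    (zero_lt_one.trans_le Fact.out).ne' hp, ENNReal.toReal_ofReal (by positivity),
    Real.rpow_inv_rpow hnonneg hpr.ne']
  rfl

theorem norm_sub_rpow_le (hp : p ≠ ∞) {ε C : ℝ}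
    (h : ∀ a b : ℝ, |a - b| ^ p.toReal ≤
      ε * (|a| ^ p.toReal + |b| ^ p.toReal) + C * midGap p.toReal a b) (f g : Lp ℝ p μ) :
    ‖f - g‖ ^ p.toReal ≤ ε * (‖f‖ ^ p.toReal + ‖g‖ ^ p.toReal) +
      C * ((‖f‖ ^ p.toReal + ‖g‖ ^ p.toReal) / 2 - ‖(2⁻¹ : ℝ) • (f + g)‖ ^ p.toReal) := by
  have hint : ∀ k : Lp ℝ p μ, Integrable (fun x => |k x| ^ p.toReal) μ := fun k =>
    (Lp.memLp k).integrable_norm_rpow (zero_lt_one.trans_le Fact.out).ne' hp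
  have hfg : Integrable (fun x => |f x| ^ p.toReal + |g x| ^ p.toReal) μ := (hint f).add (hint g)
  have hgap : Integrable (fun x => (|f x| ^ p.toReal + |g x| ^ p.toReal) / 2 -
      |((2⁻¹ : ℝ) • (f + g) : Lp ℝ p μ) x| ^ p.toReal) μ := (hfg.div_const 2).sub (hint _)
  simp only [norm_rpow_eq_integral hp]
  rw [← integral_add (hint f) (hint g), ← integral_const_mul, ← integral_div,
    ← integral_sub (hfg.div_const 2) (hint _), ← integral_const_mul,
    ← integral_add (hfg.const_mul ε) (hgap.const_mul C)]
  refine integral_mono_ae (hint _) ((hfg.const_mul ε).add (hgap.const_mul C)) ?_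
  filter_upwards [Lp.coeFn_sub f g, Lp.coeFn_smul (2⁻¹ : ℝ) (f + g), Lp.coeFn_add f g]
    with x hsub hsmul hadd
  rw [hsub, hsmul, Pi.smul_apply, hadd, smul_eq_mul, ← div_eq_inv_mul]
  exact h (f x) (g x)

theorem piLp_norm_rpow_eq_sum (hp : p ≠ ∞) (U : PiLp p fun _ : ι => Lp ℝ p μ) :
    ‖U‖ ^ p.toReal = ∑ j, ‖U j‖ ^ p.toReal := by
  have hpr := toReal_exponent_pos hp
  rw [PiLp.norm_eq_sum hpr, one_div, Real.rpow_inv_rpow (by positivity) hpr.ne']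

theorem piLp_norm_sub_rpow_le (hp : p ≠ ∞) {ε C : ℝ}
    (h : ∀ a b : ℝ, |a - b| ^ p.toReal ≤
      ε * (|a| ^ p.toReal + |b| ^ p.toReal) + C * midGap p.toReal a b)
    (U V : PiLp p fun _ : ι => Lp ℝ p μ) :
    ‖U - V‖ ^ p.toReal ≤ ε * (‖U‖ ^ p.toReal + ‖V‖ ^ p.toReal) +
      C * ((‖U‖ ^ p.toReal + ‖V‖ ^ p.toReal) / 2 - ‖(2⁻¹ : ℝ) • (U + V)‖ ^ p.toReal) := by
  simp only [piLp_norm_rpow_eq_sum hp, ← Finset.sum_add_distrib, Finset.sum_div,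
    ← Finset.sum_sub_distrib, Finset.mul_sum]
  exact Finset.sum_le_sum fun j _ => norm_sub_rpow_le hp h (U j) (V j)

theorem uniformConvexSpace_piLp (hp1 : 1 < p) (hp : p ≠ ∞) :
    UniformConvexSpace (PiLp p fun _ : ι => Lp ℝ p μ) where
  uniform_convex η hη := by
    have hq : 1 < p.toReal := by simpa using (ENNReal.toReal_lt_toReal ENNReal.one_ne_top hp).2 hp1
    have hq0 : 0 < p.toReal := one_pos.trans hq
    have hηq : 0 < η ^ p.toReal := Real.rpow_pos_of_pos hη _
    obtain ⟨C, hC, hle⟩ := exists_abs_sub_rpow_le hq (ε := η ^ p.toReal / 4) (by positivity)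
    refine ⟨η ^ p.toReal / (C * p.toReal), by positivity, fun U hU V hV hUV => ?_⟩
    have hgap := piLp_norm_sub_rpow_le hp hle U V
    rw [hU, hV, Real.one_rpow, norm_smul_of_nonneg (by norm_num)] at hgap
    have hsub : η ^ p.toReal ≤ ‖U - V‖ ^ p.toReal := Real.rpow_le_rpow hη.le hUV hq0.le
    have hbernoulli := one_add_mul_self_le_rpow_one_add (s := 2⁻¹ * ‖U + V‖ - 1)
      (by linarith [norm_nonneg (U + V)]) hq.le
    rw [add_sub_cancel] at hbernoulli
    have hmul := mul_le_mul_of_nonneg_left hbernoulli hC.le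
    rw [le_sub_comm, div_le_iff₀ (by positivity)]
    linarith

variable {E : Type*} [NormedAddCommGroup E] [NormedSpace ℝ E]

theorem two_mul_le_norm_add_of_convex {K : Set E} (hK : Convex ℝ K) {m : ℝ}
    (hm : ∀ x ∈ K, m ≤ ‖x‖) {x y : E} (hx : x ∈ K) (hy : y ∈ K) : 2 * m ≤ ‖x + y‖ := by
  have hmid := hm _ (hK.midpoint_mem hx hy)
  rw [midpoint_eq_smul_add, norm_smul_of_nonneg (by norm_num), invOf_eq_inv] at hmid
  linarith

theorem eq_of_convex_of_norm_le [StrictConvexSpace ℝ E] {K : Set E} (hK : Convex ℝ K) {x y : E}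
    (hx : x ∈ K) (hmin : ∀ z ∈ K, ‖x‖ ≤ ‖z‖) (hy : y ∈ K) (hyx : ‖y‖ ≤ ‖x‖) : y = x := by
  have hnorm : ‖y‖ = ‖x‖ := hyx.antisymm (hmin y hy)
  refine eq_of_norm_eq_of_norm_add_eq hnorm ((norm_add_le y x).antisymm ?_)
  linarith [two_mul_le_norm_add_of_convex hK hmin hy hx]

theorem exists_forall_norm_sub_lt [UniformConvexSpace E] {K : Set E} (hK : Convex ℝ K) {m : ℝ}
    (hm : ∀ x ∈ K, m ≤ ‖x‖) {η : ℝ} (hη : 0 < η) :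
    ∃ δ > 0, ∀ x ∈ K, ∀ y ∈ K, ‖x‖ < m + δ → ‖y‖ < m + δ → ‖x - y‖ < η := by
  rcases le_or_gt m 0 with hm0 | hm0
  · exact ⟨η / 2, half_pos hη, fun x _ y _ hx hy => by linarith [norm_sub_le x y]⟩
  obtain ⟨δ, hδ, hball⟩ :=
    exists_forall_closed_ball_dist_add_le_two_sub E (div_pos hη (add_pos hm0 one_pos))
  refine ⟨min 1 (δ * m / 2), by positivity, fun x hxK y hyK hx hy => ?_⟩
  set r := m + min 1 (δ * m / 2)
  have hrm : r ≤ m + 1 := add_le_add_right (min_le_left _ _) m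
  have hr0 : 0 < r := hm0.trans_le (le_add_of_nonneg_right (by positivity))
  have hr_lt : 2 * r < 2 * m + δ * r := by
    have : m < r := lt_add_of_pos_right _ (by positivity)
    nlinarith [min_le_right 1 (δ * m / 2)]
  by_contra! hxy
  have hmem : ∀ z : E, ‖z‖ < r → ‖r⁻¹ • z‖ ≤ 1 := fun z hz => by
    rw [norm_smul_of_nonneg (inv_pos.2 hr0).le, inv_mul_le_one₀ hr0]
    exact hz.le
  have hfar : η / (m + 1) ≤ ‖r⁻¹ • x - r⁻¹ • y‖ := by
    rw [← smul_sub, norm_smul_of_nonneg (inv_pos.2 hr0).le, ← div_eq_inv_mul]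
    gcongr
  have hadd := hball (hmem x hx) (hmem y hy) hfar
  rw [← smul_add, norm_smul_of_nonneg (inv_pos.2 hr0).le, inv_mul_le_iff₀ hr0] at hadd
  linarith [two_mul_le_norm_add_of_convex hK hm hxK hyK]

theorem exists_forall_norm_le_of_convex [UniformConvexSpace E] [CompleteSpace E] {K : Set E}
    (hK : Convex ℝ K) (hKc : IsClosed K) (hKne : K.Nonempty) :
    ∃ x ∈ K, ∀ y ∈ K, ‖x‖ ≤ ‖y‖ := by
  have hbdd : BddBelow (norm '' K) := ⟨0, forall_mem_image.2 fun x _ => norm_nonneg x⟩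
  have hinf : ∀ y ∈ K, sInf (norm '' K) ≤ ‖y‖ := fun y hy => csInf_le hbdd (mem_image_of_mem _ hy)
  obtain ⟨r, -, hr, hrK⟩ := exists_seq_tendsto_sInf (hKne.image norm) hbdd
  choose x hxK hxr using hrK
  have hxr' : Tendsto (fun n => ‖x n‖) atTop (𝓝 (sInf (norm '' K))) := by
    simpa only [hxr] using hr
  have hcauchy : CauchySeq x := by
    refine Metric.cauchySeq_iff.2 fun η hη => ?_
    obtain ⟨δ, hδ, hclose⟩ := exists_forall_norm_sub_lt hK hinf hη
    obtain ⟨n₀, hn₀⟩ := eventually_atTop.1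
      (hxr'.eventually (gt_mem_nhds (lt_add_of_pos_right _ hδ)))
    refine ⟨n₀, fun i hi j hj => ?_⟩
    rw [dist_eq_norm]
    exact hclose _ (hxK i) _ (hxK j) (hn₀ i hi) (hn₀ j hj)
  obtain ⟨e, he⟩ := cauchySeq_tendsto_of_complete hcauchy
  refine ⟨e, hKc.mem_of_tendsto he (Eventually.of_forall hxK), fun y hy => ?_⟩
  exact (tendsto_nhds_unique he.norm hxr').trans_le (hinf y hy)

end UniformConvexity

section CapacitaryExtremal

variable {N : ℕ} {p : ℝ≥0∞} {Ω : Set (Eucl N)} [Fact (1 ≤ p)] {A : Set (Eucl N)}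

variable (p Ω) in
/-- The functions in `W̃^{1,p}(Ω)` that have a quasi continuous version which is `≥ 1` quasi
everywhere on `A`. They form the closed convex set over which the capacity is minimized. -/
def candidates (A : Set (Eucl N)) : Set (LpJet p Ω) :=
  {U | U ∈ sobolevTilde p Ω ∧ ∃ u, IsQuasiCont p Ω u ∧ U none =ᵐ[volume.restrict Ω] u ∧
    QEOn p Ω A (fun x => 1 ≤ u x)}

theorem admissible_subset_candidates (hΩ : IsOpen Ω) (hp : p ≠ ∞) (hA : A ⊆ closure Ω) :
    admissible p Ω A ⊆ candidates p Ω A := by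
  rintro U ⟨hU, V, hV, hAV, hae⟩
  obtain ⟨u, hu, hUu⟩ := exists_isQuasiCont hΩ hp hU
  have hone : IsQuasiCont p Ω fun _ => 1 := isQuasiCont_of_continuousOn hp continuousOn_const
  have hle : ∀ᵐ x ∂volume.restrict (V ∩ Ω), 1 ≤ u x := by
    filter_upwards [hae, ae_inter_of_ae hUu] with x hx hxu
    rwa [← hxu]
  exact ⟨hU, u, hu, hUu, (hone.qeOn_le_of_ae hΩ hp hu hV hle).mono hp (subset_inter hAV hA)
    fun _ _ h => h⟩

theorem capRoot_le_of_mem_candidates (hΩ : IsOpen Ω) (hp : p ≠ ∞) (hA : A ⊆ closure Ω)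
    {U : LpJet p Ω} (hU : U ∈ candidates p Ω A) : capRoot p Ω A ≤ ‖U‖ₑ := by
  obtain ⟨hUt, u, hu, hUu, hge⟩ := hU
  exact capRoot_le_enorm_of_qeOn hΩ hp hUt hu hUu hA hge

theorem convex_candidates (hΩ : IsOpen Ω) (hp : p ≠ ∞) : Convex ℝ (candidates p Ω A) := by
  rintro U ⟨hU, u, hu, hUu, hu1⟩ V ⟨hV, v, hv, hVv, hv1⟩ a b ha hb hab
  refine ⟨(sobolevTildeSubmodule p Ω).add_mem ((sobolevTildeSubmodule p Ω).smul_mem a hU)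
    ((sobolevTildeSubmodule p Ω).smul_mem b hV), fun x => a * u x + b * v x,
    (hu.comp (continuous_const_mul a)).add hΩ hp (hv.comp (continuous_const_mul b)), ?_,
    (hu1.and hΩ hp hv1).mono hp subset_rfl fun x _ hx => ?_⟩
  · filter_upwards [coeFn_add_none (a • U) (b • V), coeFn_smul_none a U, coeFn_smul_none b V,
      hUu, hVv] with x hadd haU hbV hxu hxv
    rw [hadd, haU, hbV, hxu, hxv]
  · calc 1 = a * 1 + b * 1 := by rw [mul_one, mul_one, hab]
      _ ≤ a * u x + b * v x := by
          gcongr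
          exacts [hx.1, hx.2]

theorem compJet_mem_candidates (hΩ : IsOpen Ω) (hp : p ≠ ∞) {T : ℝ → ℝ}
    (hT : SmoothContraction T) (hT1 : T 1 = 1) {U : LpJet p Ω} (hU : U ∈ candidates p Ω A) :
    compJet hT U ∈ candidates p Ω A := by
  obtain ⟨hUt, u, hu, hUu, hge⟩ := hU
  refine ⟨compJet_mem_sobolevTilde hΩ hp hT hUt, fun x => T (u x),
    hu.comp hT.contDiff.continuous, ?_,
    hge.mono hp subset_rfl fun x _ hx => hT1.ge.trans (hT.monotone hx)⟩
  filter_upwards [coeFn_compJet_none hT U, hUu] with x hx hxu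
  rw [hx, hxu]

theorem capRoot_setOf_le_one_sub (hΩ : IsOpen Ω) (hp : p ≠ ∞) (hA : A ⊆ closure Ω)
    {U V : LpJet p Ω} (hU : U ∈ candidates p Ω A) (hV : V ∈ sobolevTilde p Ω)
    {v : Eucl N → ℝ} (hv : IsQuasiCont p Ω v) (hVv : V none =ᵐ[volume.restrict Ω] v)
    {c : ℝ} (hc : 0 < c) :
    capRoot p Ω {x ∈ A | c ≤ 1 - v x} ≤ ENNReal.ofReal (‖U - V‖ / c) := by
  obtain ⟨hUt, u, hu, hUu, hge⟩ := hU
  rw [qeOn_iff_capRoot hp] at hge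
  have hsub : {x ∈ A | c ≤ 1 - v x} ⊆
      {x ∈ closure Ω | c ≤ u x - v x} ∪ {x ∈ A | ¬ 1 ≤ u x} := fun x hx =>
    (em (1 ≤ u x)).imp (fun hux => ⟨hA hx.1, hx.2.trans (sub_le_sub_right hux _)⟩) (⟨hx.1, ·⟩)
  calc capRoot p Ω {x ∈ A | c ≤ 1 - v x}
      ≤ capRoot p Ω {x ∈ closure Ω | c ≤ u x - v x} + capRoot p Ω {x ∈ A | ¬ 1 ≤ u x} :=
        (capRoot_mono hsub).trans (capRoot_union_le hΩ hp _ _)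
    _ = capRoot p Ω {x ∈ closure Ω | c ≤ u x - v x} := by rw [hge, add_zero]
    _ ≤ ENNReal.ofReal (‖U - V‖ / c) :=
        capRoot_setOf_le hΩ hp ((sobolevTildeSubmodule p Ω).sub_mem hUt hV) (hu.sub hΩ hp hv)
          ((coeFn_sub_none U V).trans (hUu.sub hVv)) hc

theorem isClosed_candidates (hΩ : IsOpen Ω) (hp : p ≠ ∞) (hA : A ⊆ closure Ω) :
    IsClosed (candidates p Ω A) := by
  refine IsSeqClosed.isClosed fun U V hU hUV => ?_
  have hV : V ∈ sobolevTilde p Ω := (isClosed_sobolevTilde p Ω).mem_of_tendsto hUV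
    (Eventually.of_forall fun n => (hU n).1)
  obtain ⟨v, hv, hVv⟩ := exists_isQuasiCont hΩ hp hV
  have hlevel : ∀ k : ℕ, capRoot p Ω {x ∈ A | 1 / (k + 1 : ℝ) ≤ 1 - v x} = 0 := fun k => by
    have hlim : Tendsto (fun n => ENNReal.ofReal (‖U n - V‖ / (1 / (k + 1 : ℝ)))) atTop (𝓝 0) := by
      simpa using ENNReal.tendsto_ofReal
        ((tendsto_iff_norm_sub_tendsto_zero.1 hUV).div_const (1 / (k + 1 : ℝ)))
    exact le_antisymm (ge_of_tendsto' hlim fun n =>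
      capRoot_setOf_le_one_sub hΩ hp hA (hU n) hV hv hVv Nat.one_div_pos_of_nat) zero_le
  refine ⟨hV, v, hv, hVv, (qeOn_iff_capRoot hp).2 ?_⟩
  have hunion := capRoot_iUnion_le hΩ hp fun k : ℕ => {x ∈ A | 1 / (k + 1 : ℝ) ≤ 1 - v x}
  simp only [hlevel, tsum_zero] at hunion
  refine capRoot_eq_zero_of_subset (fun x hx => ?_) (le_antisymm hunion zero_le)
  obtain ⟨k, hk⟩ := exists_nat_one_div_lt (sub_pos.2 (not_le.1 hx.2))
  exact mem_iUnion.2 ⟨k, hx.1, hk.le⟩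

theorem exists_minimal_candidate (hΩ : IsOpen Ω) (hp1 : 1 < p) (hp : p ≠ ∞)
    (hA : A ⊆ closure Ω) (hcap : relCap p Ω A < ∞) :
    ∃ U ∈ candidates p Ω A, ‖U‖ₑ = capRoot p Ω A := by
  have := uniformConvexSpace_piLp (ι := Option (Fin N)) (μ := volume.restrict Ω) hp1 hp
  obtain ⟨V, hV, -⟩ : ∃ V ∈ admissible p Ω A, ‖V‖ₑ ^ p.toReal < ∞ := by
    simpa only [relCap, iInf_lt_iff, exists_prop] using hcap
  obtain ⟨U, hU, hmin⟩ := exists_forall_norm_le_of_convex (convex_candidates hΩ hp)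
    (isClosed_candidates hΩ hp hA) ⟨V, admissible_subset_candidates hΩ hp hA hV⟩
  exact ⟨U, hU, le_antisymm (le_iInf₂ fun W hW =>
      enorm_le_iff_norm_le.2 (hmin W (admissible_subset_candidates hΩ hp hA hW)))
    (capRoot_le_of_mem_candidates hΩ hp hA hU)⟩

theorem eq_of_enorm_le_capRoot (hΩ : IsOpen Ω) (hp1 : 1 < p) (hp : p ≠ ∞)
    (hA : A ⊆ closure Ω) {U V : LpJet p Ω} (hU : U ∈ candidates p Ω A)
    (hUA : ‖U‖ₑ ≤ capRoot p Ω A) (hV : V ∈ candidates p Ω A) (hVA : ‖V‖ₑ ≤ capRoot p Ω A) :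
    V = U := by
  have := uniformConvexSpace_piLp (ι := Option (Fin N)) (μ := volume.restrict Ω) hp1 hp
  have hmin : ∀ W ∈ candidates p Ω A, ∀ Z : LpJet p Ω, ‖Z‖ₑ ≤ capRoot p Ω A → ‖Z‖ ≤ ‖W‖ :=
    fun W hW Z hZ => enorm_le_iff_norm_le.1
      (hZ.trans (capRoot_le_of_mem_candidates hΩ hp hA hW))
  exact eq_of_convex_of_norm_le (convex_candidates hΩ hp) hU (fun W hW => hmin W hW U hUA) hV
    (hmin U hU V hVA)

theorem ae_mem_Icc_of_enorm_le_capRoot (hΩ : IsOpen Ω) (hp1 : 1 < p) (hp : p ≠ ∞)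
    (hA : A ⊆ closure Ω) {U : LpJet p Ω} (hU : U ∈ candidates p Ω A)
    (hUA : ‖U‖ₑ ≤ capRoot p Ω A) : ∀ᵐ x ∂volume.restrict Ω, U none x ∈ Icc 0 1 := by
  have hT := smoothContraction_softClamp
  have hfix : compJet hT U = U := eq_of_enorm_le_capRoot hΩ hp1 hp hA hU hUA
    (compJet_mem_candidates hΩ hp hT softClamp_one hU)
    ((enorm_le_iff_norm_le.2 (norm_compJet_le hp hT U)).trans hUA)
  filter_upwards [coeFn_compJet_none hT U] with x hx
  rw [hfix] at hx
  exact mem_Icc_of_softClamp_eq_self hx.symm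

theorem mem_qeClass_self (hp : p ≠ ∞) {u : Eucl N → ℝ} (hu : IsQuasiCont p Ω u) :
    u ∈ qeClass p Ω u :=
  ⟨hu, by simp [qeOn_iff_capRoot hp, capRoot_empty]⟩

theorem qeClass_subset_of_qeOn_eq (hΩ : IsOpen Ω) (hp : p ≠ ∞) {u v : Eucl N → ℝ}
    (h : QEOn p Ω (closure Ω) (fun x => u x = v x)) : qeClass p Ω u ⊆ qeClass p Ω v :=
  fun _ hw => ⟨hw.1, (hw.2.and hΩ hp h).mono hp subset_rfl fun _ _ hx => hx.1.trans hx.2⟩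

theorem exists_isRefinement (hΩ : IsOpen Ω) (hp : p ≠ ∞) {U : LpJet p Ω}
    (hU : U ∈ sobolevTilde p Ω) : ∃ c, IsRefinement p Ω U c := by
  obtain ⟨u, hu, hUu⟩ := exists_isQuasiCont hΩ hp hU
  exact ⟨qeClass p Ω u, u, hu, hUu, rfl⟩

theorem IsRefinement.qeOn_eq (hΩ : IsOpen Ω) (hp : p ≠ ∞) {U : LpJet p Ω}
    {c : Set (Eucl N → ℝ)} (hc : IsRefinement p Ω U c) {u v : Eucl N → ℝ} (hu : u ∈ c)
    (hv : IsQuasiCont p Ω v) (hUv : U none =ᵐ[volume.restrict Ω] v) :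
    QEOn p Ω (closure Ω) (fun x => u x = v x) := by
  obtain ⟨w, hw, hUw, rfl⟩ := hc
  exact (hu.2.and hΩ hp (hw.qeOn_closure_eq_of_ae hΩ hp hv (hUw.symm.trans hUv))).mono hp
    subset_rfl fun _ _ hx => hx.1.trans hx.2

theorem IsRefinement.unique (hΩ : IsOpen Ω) (hp : p ≠ ∞) {U : LpJet p Ω}
    {c d : Set (Eucl N → ℝ)} (hc : IsRefinement p Ω U c) (hd : IsRefinement p Ω U d) : c = d := by
  obtain ⟨u, hu, hUu, rfl⟩ := hc
  obtain ⟨v, hv, hUv, rfl⟩ := hd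
  exact Subset.antisymm
    (qeClass_subset_of_qeOn_eq hΩ hp (hu.qeOn_closure_eq_of_ae hΩ hp hv (hUu.symm.trans hUv)))
    (qeClass_subset_of_qeOn_eq hΩ hp (hv.qeOn_closure_eq_of_ae hΩ hp hu (hUv.symm.trans hUu)))

theorem IsRefinement.qeOn_le_and_le (hΩ : IsOpen Ω) (hp : p ≠ ∞) {U : LpJet p Ω}
    {c : Set (Eucl N → ℝ)} (hc : IsRefinement p Ω U c) {a b : ℝ}
    (hab : ∀ᵐ x ∂volume.restrict Ω, U none x ∈ Icc a b) {u : Eucl N → ℝ} (hu : u ∈ c) :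
    QEOn p Ω (closure Ω) (fun x => a ≤ u x ∧ u x ≤ b) := by
  have hconst : ∀ t : ℝ, IsQuasiCont p Ω fun _ => t := fun t =>
    isQuasiCont_of_continuousOn hp continuousOn_const
  obtain ⟨v, hv, hUv, -⟩ := id hc
  have hv_ge := (hconst a).qeOn_closure_le_of_ae hΩ hp hv (by
    filter_upwards [hab, hUv] with x hx hxv using hxv ▸ hx.1)
  have hv_le := hv.qeOn_closure_le_of_ae hΩ hp (hconst b) (by
    filter_upwards [hab, hUv] with x hx hxv using hxv ▸ hx.2)
  exact ((hv_ge.and hΩ hp hv_le).and hΩ hp (hc.qeOn_eq hΩ hp hu hv hUv)).mono hp subset_rfl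
    fun x _ hx => hx.2 ▸ hx.1

theorem isExtremal_iff (hΩ : IsOpen Ω) (hp : p ≠ ∞) (hA : A ⊆ closure Ω)
    {c : Set (Eucl N → ℝ)} :
    IsExtremal p Ω A c ↔
      ∃ U ∈ candidates p Ω A, ‖U‖ₑ = capRoot p Ω A ∧ IsRefinement p Ω U c := by
  have hnorm : ∀ U : LpJet p Ω, ‖U‖ₑ ^ p.toReal = relCap p Ω A ↔ ‖U‖ₑ = capRoot p Ω A := fun U => by
    rw [relCap_eq_capRoot_rpow hp,
      (ENNReal.rpow_left_injective (toReal_exponent_pos hp).ne').eq_iff]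
  constructor
  · rintro ⟨U, hU, ⟨u, hu, hUu, rfl⟩, hge, hUA⟩
    exact ⟨U, ⟨hU, u, hu, hUu, hge u (mem_qeClass_self hp hu)⟩, (hnorm U).1 hUA, u, hu, hUu, rfl⟩
  · rintro ⟨U, ⟨hU, u, hu, hUu, hge⟩, hUA, hc⟩
    refine ⟨U, hU, hc, fun v hv => ?_, (hnorm U).2 hUA⟩
    exact (hge.and hΩ hp ((hc.qeOn_eq hΩ hp hv hu hUu).mono hp hA fun _ _ hx => hx)).mono hp
      subset_rfl fun x _ hx => hx.2 ▸ hx.1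

end CapacitaryExtremal

end RelativeCapacity

end

open RelativeCapacity in
theorem mainTheorem6 (N : ℕ) (Ω : Set (Eucl N)) (hΩ : IsOpen Ω) (hΩne : Ω.Nonempty)
    (p : ℝ≥0∞) [Fact (1 ≤ p)] (hp : 1 < p) (hp' : p < ∞)
    (A : Set (Eucl N)) (hA : A ⊆ closure Ω) (hcap : relCap p Ω A < ∞) :
    ∃ e : Set (Eucl N → ℝ),
      IsExtremal p Ω A e ∧
      (∀ w, IsExtremal p Ω A w → w = e) ∧
      (∀ u ∈ e, QEOn p Ω (closure Ω) (fun x => 0 ≤ u x ∧ u x ≤ 1)) ∧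
      (∀ u ∈ e, QEOn p Ω A (fun x => u x = 1)) := by
  obtain ⟨U, hU, hUA⟩ := exists_minimal_candidate hΩ hp hp'.ne hA hcap
  obtain ⟨e, he⟩ := exists_isRefinement hΩ hp'.ne hU.1
  have hext : IsExtremal p Ω A e := (isExtremal_iff hΩ hp'.ne hA).2 ⟨U, hU, hUA, he⟩
  have hIcc : ∀ u ∈ e, QEOn p Ω (closure Ω) (fun x => 0 ≤ u x ∧ u x ≤ 1) := fun u hu =>
    he.qeOn_le_and_le hΩ hp'.ne (ae_mem_Icc_of_enorm_le_capRoot hΩ hp hp'.ne hA hU hUA.le) hu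
  refine ⟨e, hext, fun w hw => ?_, hIcc, fun u hu => ?_⟩
  · obtain ⟨V, hV, hVA, hVw⟩ := (isExtremal_iff hΩ hp'.ne hA).1 hw
    obtain rfl : V = U := eq_of_enorm_le_capRoot hΩ hp hp'.ne hA hU hUA.le hV hVA.le
    exact hVw.unique hΩ hp'.ne he
  · obtain ⟨_, _, _, hge, _⟩ := hext
    have hle := (hIcc u hu).mono hp'.ne hA fun _ _ hx => hx.2
    exact (hle.and hΩ hp'.ne (hge u hu)).mono hp'.ne subset_rfl fun x _ hx => le_antisymm hx.1 hx.2
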